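/- For a C*-algebra $A$ let $\mathcal K$ be the compact operators on a separable infinite-dimensional Hilbert space and let $V(A)$ be the set of Murray--von Neumann equivalence classes of projections in $A\otimes\mathcal K$ (where $p\sim q$ if $x^*x=p$, $xx^*=q$ for some $x \in A\otimes\mathcal K$). It is a pre-ordered commutative monoid under orthogonal direct sum, $[p]+[q]=[p\oplus q]$, with $[p]\le[q]$ if $p$ is equivalent to a sub-projection of $q$; a $*$-homomorphism $f$ induces a morphism $V(f)$, $[p]\mapsto[(f\otimes\mathrm{id})(p)]$. A C*-algebra $A$ is *stable* if $A\cong A\otimes\mathcal K$, has *real rank zero* if the invertible self-adjoint elements are dense in the self-adjoint elements (of its unitization, if $A$ is non-unital), and is *infinite* if it contains an infinite projection, that is, a projection equivalent to a proper sub-projection of itself. Let $$0\to B_i\xrightarrow{\iota_i}E_i\xrightarrow{\pi_i}A_i\to0,\qquad i=1,2,$$ be two extensions of C*-algebras, where all of $B_i,E_i,A_i$ are stable and of real rank zero. Suppose that $\alpha:V(E_1)\to V(E_2)$ and $\alpha_0:V(B_1)\to V(B_2)$ are isomorphisms of pre-ordered monoids such that $\alpha_0$ is the restriction of $\alpha$,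 i.e. $\alpha\circ V(\iota_1)=V(\iota_2)\circ\alpha_0$. Then $A_1$ is infinite if and only if $A_2$ is infinite. -/

import Mathlib

noncomputable section

universe u v w

/-- Infinite matrices over `A`, indexed by `ℕ × ℕ`, with only finitely many nonzero entries:
the increasing union of the matrix algebras `Mₙ(A)`. -/
@[ext]
structure FinMat (A : Type u) [Zero A] where
  entry : ℕ → ℕ → A
  finite : ∃ n, ∀ i j, n ≤ i ∨ n ≤ j → entry i j = 0

namespace FinMat

section Algebra

variable {A : Type u} [NonUnitalCStarAlgebra A]

/-- `a` lives in the upper left `n × n` corner. -/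
def Bound (a : FinMat A) (n : ℕ) : Prop := ∀ i j, n ≤ i ∨ n ≤ j → a.entry i j = 0

theorem exists_bound (a : FinMat A) : ∃ n, a.Bound n := a.finite

theorem Bound.mono {a : FinMat A} {n m : ℕ} (h : a.Bound n) (hnm : n ≤ m) : a.Bound m :=
  fun i j hij => h i j (by omega)

theorem exists_bound₂ (a b : FinMat A) : ∃ n, a.Bound n ∧ b.Bound n := by
  obtain ⟨n, hn⟩ := a.exists_bound
  obtain ⟨m, hm⟩ := b.exists_bound
  exact ⟨max n m, hn.mono (le_max_left _ _), hm.mono (le_max_right _ _)⟩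

instance : Zero (FinMat A) := ⟨⟨0, 0, fun _ _ _ => rfl⟩⟩

instance : Add (FinMat A) := ⟨fun a b => ⟨a.entry + b.entry, by
  obtain ⟨n, ha, hb⟩ := exists_bound₂ a b
  exact ⟨n, fun i j h => by simp [ha i j h, hb i j h]⟩⟩⟩

instance : Neg (FinMat A) := ⟨fun a => ⟨-a.entry, by
  obtain ⟨n, ha⟩ := a.exists_bound
  exact ⟨n, fun i j h => by simp [ha i j h]⟩⟩⟩

instance : Sub (FinMat A) := ⟨fun a b => ⟨a.entry - b.entry, by
  obtain ⟨n, ha, hb⟩ := exists_bound₂ a b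
  exact ⟨n, fun i j h => by simp [ha i j h, hb i j h]⟩⟩⟩

instance {R : Type*} [SMulZeroClass R A] : SMul R (FinMat A) := ⟨fun c a => ⟨c • a.entry, by
  obtain ⟨n, ha⟩ := a.exists_bound
  exact ⟨n, fun i j h => by simp [ha i j h]⟩⟩⟩

instance : Star (FinMat A) := ⟨fun a => ⟨fun i j => star (a.entry j i), by
  obtain ⟨n, ha⟩ := a.exists_bound
  exact ⟨n, fun i j h => by rw [ha j i h.symm, star_zero]⟩⟩⟩

/-- Matrix multiplication; the sum has only finitely many nonzero terms. -/
instance : Mul (FinMat A) := ⟨fun a b => ⟨fun i j => ∑ᶠ k, a.entry i k * b.entry k j, by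
  obtain ⟨n, ha, hb⟩ := exists_bound₂ a b
  refine ⟨n, fun i j h => ?_⟩
  rw [← finsum_zero (α := ℕ)]
  refine finsum_congr fun k => ?_
  rcases h with h | h
  · rw [ha i k (Or.inl h), zero_mul]
  · rw [hb k j (Or.inr h), mul_zero]⟩⟩

theorem entry_injective : Function.Injective (entry : FinMat A → ℕ → ℕ → A) :=
  fun _ _ h => FinMat.ext h

instance : AddCommGroup (FinMat A) :=
  Function.Injective.addCommGroup entry entry_injective rfl (fun _ _ => rfl) (fun _ => rfl)
    (fun _ _ => rfl) (fun _ _ => rfl) (fun _ _ => rfl)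

instance : Module ℂ (FinMat A) :=
  Function.Injective.module ℂ ⟨⟨entry, rfl⟩, fun _ _ => rfl⟩ entry_injective (fun _ _ => rfl)

@[simp] theorem zero_entry (i j : ℕ) : (0 : FinMat A).entry i j = 0 := rfl
@[simp] theorem add_entry (a b : FinMat A) (i j : ℕ) :
    (a + b).entry i j = a.entry i j + b.entry i j := rfl
@[simp] theorem smul_entry (c : ℂ) (a : FinMat A) (i j : ℕ) :
    (c • a).entry i j = c • a.entry i j := rfl
@[simp] theorem star_entry (a : FinMat A) (i j : ℕ) :
    (star a).entry i j = star (a.entry j i) := rfl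
theorem mul_entry' (a b : FinMat A) (i j : ℕ) :
    (a * b).entry i j = ∑ᶠ k, a.entry i k * b.entry k j := rfl

theorem mul_entry {a : FinMat A} {n : ℕ} (ha : a.Bound n) (b : FinMat A) (i j : ℕ) :
    (a * b).entry i j = ∑ k ∈ Finset.range n, a.entry i k * b.entry k j := by
  rw [mul_entry']
  refine finsum_eq_sum_of_support_subset _ fun k hk => ?_
  by_contra hk'
  refine hk ?_
  simp only [Finset.coe_range, Set.mem_Iio, not_lt] at hk'
  simp only [ha i k (Or.inr hk'), zero_mul]

theorem Bound.mul {a b : FinMat A} {n : ℕ} (ha : a.Bound n) (hb : b.Bound n) :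
    (a * b).Bound n := fun i j h => by
  rw [mul_entry ha]
  refine Finset.sum_eq_zero fun k _ => ?_
  rcases h with h | h
  · rw [ha i k (Or.inl h), zero_mul]
  · rw [hb k j (Or.inr h), mul_zero]

theorem Bound.add {a b : FinMat A} {n : ℕ} (ha : a.Bound n) (hb : b.Bound n) :
    (a + b).Bound n := fun i j h => by simp [ha i j h, hb i j h]

theorem Bound.star {a : FinMat A} {n : ℕ} (ha : a.Bound n) : (star a).Bound n :=
  fun i j h => by simp [ha j i h.symm]

theorem Bound.smul {a : FinMat A} {n : ℕ} (ha : a.Bound n) (c : ℂ) : (c • a).Bound n :=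
  fun i j h => by simp [ha i j h]

instance : NonUnitalRing (FinMat A) where
  left_distrib a b c := by
    obtain ⟨n, ha⟩ := a.exists_bound
    ext i j
    simp [mul_entry ha, mul_add, Finset.sum_add_distrib]
  right_distrib a b c := by
    obtain ⟨n, ha, hb⟩ := exists_bound₂ a b
    ext i j
    simp [mul_entry ha, mul_entry hb, mul_entry (ha.add hb), add_mul, Finset.sum_add_distrib]
  zero_mul a := by
    ext i j
    simp [mul_entry' 0]
  mul_zero a := by
    ext i j
    simp [mul_entry' a]
  mul_assoc a b c := by
    obtain ⟨n, ha, hb⟩ := exists_bound₂ a b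
    ext i j
    simp only [mul_entry ha, mul_entry hb, mul_entry (ha.mul hb), Finset.sum_mul, Finset.mul_sum,
      mul_assoc]
    exact Finset.sum_comm

instance : StarRing (FinMat A) where
  star_involutive a := by ext i j; simp
  star_add a b := by ext i j; simp
  star_mul a b := by
    obtain ⟨n, ha, hb⟩ := exists_bound₂ a b
    ext i j
    simp [mul_entry ha, mul_entry hb.star, star_sum]

instance : IsScalarTower ℂ (FinMat A) (FinMat A) where
  smul_assoc c a b := by
    obtain ⟨n, ha⟩ := a.exists_bound
    ext i j
    simp [mul_entry ha, mul_entry (ha.smul c), Finset.smul_sum, smul_mul_assoc]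

instance : SMulCommClass ℂ (FinMat A) (FinMat A) where
  smul_comm c a b := by
    obtain ⟨n, ha⟩ := a.exists_bound
    ext i j
    simp [mul_entry ha, Finset.smul_sum, mul_smul_comm]

instance : StarModule ℂ (FinMat A) where
  star_smul c a := by ext i j; simp

end Algebra

section Norm

variable {A : Type u} [NonUnitalCStarAlgebra A]

attribute [local instance] CStarAlgebra.spectralOrder CStarAlgebra.spectralOrderedRing

/-- The upper left `n × n` corner of `a`. -/
def trunc (n : ℕ) (a : FinMat A) : CStarMatrix (Fin n) (Fin n) A :=
  CStarMatrix.ofMatrix fun i j => a.entry i j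

theorem trunc_apply (n : ℕ) (a : FinMat A) (i j : Fin n) : trunc n a i j = a.entry i j := rfl

theorem trunc_mul {a : FinMat A} {n : ℕ} (ha : a.Bound n) (b : FinMat A) :
    trunc n (a * b) = trunc n a * trunc n b := by
  ext i j
  rw [trunc_apply, mul_entry ha, CStarMatrix.mul_apply, Finset.sum_range]
  rfl

/-- The inclusion of `Mₙ(A)` as upper left corner. -/
def corner (n : ℕ) : CStarMatrix (Fin n) (Fin n) A →⋆ₙₐ[ℂ] FinMat A where
  toFun M := ⟨fun i j => if h : i < n ∧ j < n then M ⟨i, h.1⟩ ⟨j, h.2⟩ else 0,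
    n, fun i j h => dif_neg (by omega)⟩
  map_smul' c M := by
    ext i j
    by_cases h : i < n ∧ j < n <;> simp [h]
  map_zero' := by
    ext i j
    by_cases h : i < n ∧ j < n <;> simp
  map_add' M N := by
    ext i j
    by_cases h : i < n ∧ j < n <;> simp [h]
  map_mul' M N := by
    ext i j
    rw [mul_entry (n := n) (fun i j h => dif_neg (by omega)), Finset.sum_range]
    by_cases h : i < n ∧ j < n
    · simp [h, CStarMatrix.mul_apply]
    · refine (dif_neg h).trans (Eq.symm ?_)
      refine Finset.sum_eq_zero fun k _ => ?_
      by_cases hi : i < n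
      · have hj : ¬ j < n := fun hj => h ⟨hi, hj⟩
        simp [hj]
      · simp [hi]
  map_star' M := by
    ext i j
    by_cases h : i < n ∧ j < n
    · simp [h, CStarMatrix.star_apply]
    · have h' : ¬ (j < n ∧ i < n) := fun h' => h h'.symm
      simp [h, h']

theorem corner_entry (n : ℕ) (M : CStarMatrix (Fin n) (Fin n) A) (i j : ℕ) :
    (corner n M).entry i j = if h : i < n ∧ j < n then M ⟨i, h.1⟩ ⟨j, h.2⟩ else 0 := rfl

theorem corner_bound (n : ℕ) (M : CStarMatrix (Fin n) (Fin n) A) : (corner n M).Bound n :=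
  fun i j h => dif_neg (by omega)

theorem trunc_corner (n : ℕ) (M : CStarMatrix (Fin n) (Fin n) A) : trunc n (corner n M) = M := by
  ext i j
  simp [trunc_apply, corner_entry]

theorem corner_trunc {a : FinMat A} {n : ℕ} (ha : a.Bound n) : corner n (trunc n a) = a := by
  ext i j
  rw [corner_entry]
  split_ifs with h
  · rfl
  · exact (ha i j (by omega)).symm

/-- The inclusion of `Mₙ(A)` in `Mₘ(A)` as upper left corner, for `n ≤ m`. -/
def inclusion {n m : ℕ} (h : n ≤ m) :
    CStarMatrix (Fin n) (Fin n) A →⋆ₙₐ[ℂ] CStarMatrix (Fin m) (Fin m) A where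
  toFun M := trunc m (corner n M)
  map_smul' c M := by rw [map_smul]; rfl
  map_zero' := by rw [map_zero]; rfl
  map_add' M N := by rw [map_add]; rfl
  map_mul' M N := by rw [map_mul, trunc_mul ((corner_bound n M).mono h)]
  map_star' M := by rw [map_star]; rfl

theorem norm_trunc {a : FinMat A} {n m : ℕ} (ha : a.Bound n) (h : n ≤ m) :
    ‖trunc m a‖ = ‖trunc n a‖ := by
  have hinj : Function.Injective (inclusion (A := A) h) := fun M N hMN => by
    have h1 : trunc m (corner n M) = trunc m (corner n N) := hMN
    have h2 := congrArg (fun x => trunc n (corner m x)) h1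
    simpa only [corner_trunc ((corner_bound n _).mono h), trunc_corner] using h2
  have := NonUnitalStarAlgHom.norm_map (inclusion (A := A) h) hinj (trunc n a)
  rw [← this]
  change _ = ‖trunc m (corner n (trunc n a))‖
  rw [corner_trunc ha]

/-- The C⋆-norm: the norm of `a` in any `Mₙ(A)` that contains it. -/
instance : Norm (FinMat A) := ⟨fun a => ‖trunc a.exists_bound.choose a‖⟩

theorem norm_eq {a : FinMat A} {n : ℕ} (ha : a.Bound n) : ‖a‖ = ‖trunc n a‖ := by
  change ‖trunc a.exists_bound.choose a‖ = _
  rw [← norm_trunc ha (le_max_left n a.exists_bound.choose),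
    ← norm_trunc a.exists_bound.choose_spec (le_max_right n a.exists_bound.choose)]

theorem normCore : NormedSpace.Core ℂ (FinMat A) where
  norm_nonneg a := norm_nonneg (trunc _ a)
  norm_smul c a := by
    obtain ⟨n, ha⟩ := a.exists_bound
    rw [norm_eq ha, norm_eq (ha.smul c)]
    exact norm_smul c (trunc n a)
  norm_triangle a b := by
    obtain ⟨n, ha, hb⟩ := exists_bound₂ a b
    rw [norm_eq ha, norm_eq hb, norm_eq (ha.add hb)]
    exact norm_add_le (trunc n a) (trunc n b)
  norm_eq_zero_iff a := by
    obtain ⟨n, ha⟩ := a.exists_bound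
    rw [norm_eq ha, norm_eq_zero]
    constructor
    · intro h
      rw [← corner_trunc ha, h, map_zero]
    · rintro rfl
      rfl

instance : NormedAddCommGroup (FinMat A) := NormedAddCommGroup.ofCore normCore

instance : NormedSpace ℂ (FinMat A) := NormedSpace.ofCore normCore

instance : NonUnitalNormedRing (FinMat A) where
  dist_eq := NormedAddCommGroup.dist_eq
  norm_mul_le a b := by
    obtain ⟨n, ha, hb⟩ := exists_bound₂ a b
    rw [norm_eq ha, norm_eq hb, norm_eq (ha.mul hb), trunc_mul ha]
    exact norm_mul_le _ _

instance : CStarRing (FinMat A) where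
  norm_mul_self_le a := by
    obtain ⟨n, ha⟩ := a.exists_bound
    rw [norm_eq ha, norm_eq (ha.star.mul ha), trunc_mul ha.star]
    exact CStarRing.norm_mul_self_le (trunc n a)

theorem norm_corner (n : ℕ) (M : CStarMatrix (Fin n) (Fin n) A) : ‖corner n M‖ = ‖M‖ := by
  rw [norm_eq (corner_bound n M), trunc_corner]

/-- Every ⋆-homomorphism from the union of the `Mₙ(A)` to a C⋆-algebra is contractive. -/
theorem norm_hom_le {D : Type v} [NonUnitalCStarAlgebra D] (φ : FinMat A →⋆ₙₐ[ℂ] D)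
    (a : FinMat A) : ‖φ a‖ ≤ ‖a‖ := by
  obtain ⟨n, ha⟩ := a.exists_bound
  have := NonUnitalStarAlgHom.norm_apply_le (φ.comp (corner n)) (trunc n a)
  rwa [NonUnitalStarAlgHom.comp_apply, corner_trunc ha, ← norm_eq ha] at this

end Norm

end FinMat

namespace FinMat

section Shift

variable {A : Type u} [NonUnitalCStarAlgebra A]

/-- The linear map with `a ⊗ e_{ij} ↦ a ⊗ e_{g(i) h(j)}`. -/
def shift (g h : ℕ ↪ ℕ) : FinMat A →+ FinMat A where
  toFun a := ⟨Function.extend g (fun i => Function.extend h (a.entry i) 0) 0, by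
    obtain ⟨n, ha⟩ := a.exists_bound
    refine ⟨((Finset.range n).sup g ⊔ (Finset.range n).sup h) + 1, fun r s hrs => ?_⟩
    by_cases hr : ∃ i, g i = r
    · obtain ⟨i, rfl⟩ := hr
      rw [g.injective.extend_apply]
      by_cases hs : ∃ j, h j = s
      · obtain ⟨j, rfl⟩ := hs
        rw [h.injective.extend_apply]
        by_contra hne
        have hi : i < n := by
          by_contra hi
          exact hne (ha i j (Or.inl (by omega)))
        have hj : j < n := by
          by_contra hj
          exact hne (ha i j (Or.inr (by omega)))
        have h1 := Finset.le_sup (f := g) (Finset.mem_range.2 hi)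
        have h2 := Finset.le_sup (f := h) (Finset.mem_range.2 hj)
        have h3 := le_max_left ((Finset.range n).sup g) ((Finset.range n).sup h)
        have h4 := le_max_right ((Finset.range n).sup g) ((Finset.range n).sup h)
        omega
      · rw [Function.extend_apply' _ _ _ hs]
        rfl
    · rw [Function.extend_apply' _ _ _ hr]
      rfl⟩
  map_zero' := by
    ext r s
    by_cases hr : ∃ i, g i = r
    · obtain ⟨i, rfl⟩ := hr
      simp only [g.injective.extend_apply, zero_entry]
      by_cases hs : ∃ j, h j = s
      · obtain ⟨j, rfl⟩ := hs
        simp [h.injective.extend_apply]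
      · simp [Function.extend_apply' _ _ _ hs]
    · simp [Function.extend_apply' _ _ _ hr]
  map_add' a b := by
    ext r s
    by_cases hr : ∃ i, g i = r
    · obtain ⟨i, rfl⟩ := hr
      simp only [g.injective.extend_apply, add_entry]
      by_cases hs : ∃ j, h j = s
      · obtain ⟨j, rfl⟩ := hs
        simp [h.injective.extend_apply]
      · simp [Function.extend_apply' _ _ _ hs]
    · simp [Function.extend_apply' _ _ _ hr]

@[simp] theorem shift_entry (g h : ℕ ↪ ℕ) (a : FinMat A) (i j : ℕ) :
    (shift g h a).entry (g i) (h j) = a.entry i j := by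
  change Function.extend g (fun i => Function.extend h (a.entry i) 0) 0 (g i) (h j) = _
  rw [g.injective.extend_apply, h.injective.extend_apply]

theorem shift_entry_left (g h : ℕ ↪ ℕ) (a : FinMat A) {r : ℕ} (hr : r ∉ Set.range g) (s : ℕ) :
    (shift g h a).entry r s = 0 := by
  change Function.extend g (fun i => Function.extend h (a.entry i) 0) 0 r s = _
  rw [Function.extend_apply' _ _ _ hr]
  rfl

theorem shift_entry_right (g h : ℕ ↪ ℕ) (a : FinMat A) (r : ℕ) {s : ℕ} (hs : s ∉ Set.range h) :
    (shift g h a).entry r s = 0 := by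
  by_cases hr : r ∈ Set.range g
  · obtain ⟨i, rfl⟩ := hr
    change Function.extend g (fun i => Function.extend h (a.entry i) 0) 0 (g i) s = _
    rw [g.injective.extend_apply, Function.extend_apply' _ _ _ hs]
    rfl
  · exact shift_entry_left g h a hr s

theorem shift_star (g h : ℕ ↪ ℕ) (a : FinMat A) : shift h g (star a) = star (shift g h a) := by
  ext r s
  rw [star_entry]
  by_cases hr : r ∈ Set.range h
  · by_cases hs : s ∈ Set.range g
    · obtain ⟨i, rfl⟩ := hr
      obtain ⟨j, rfl⟩ := hs
      simp
    · rw [shift_entry_right _ _ _ _ hs, shift_entry_left _ _ _ hs, star_zero]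
  · rw [shift_entry_right _ _ _ _ hr, shift_entry_left _ _ _ hr, star_zero]

theorem shift_mul (g h k : ℕ ↪ ℕ) (a b : FinMat A) :
    shift g h a * shift h k b = shift g k (a * b) := by
  ext r s
  rw [mul_entry']
  by_cases hr : r ∈ Set.range g
  · by_cases hs : s ∈ Set.range k
    · obtain ⟨i, rfl⟩ := hr
      obtain ⟨j, rfl⟩ := hs
      rw [shift_entry, mul_entry', ← finsum_mem_univ,
        finsum_mem_inter_support_eq'
          (fun t => (shift g h a).entry (g i) t * (shift h k b).entry t (k j)) Set.univ
          (Set.range h), finsum_mem_range h.injective]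
      · simp
      · intro t ht
        simp only [Set.mem_univ, true_iff]
        by_contra ht'
        exact ht (by simp [shift_entry_left _ _ _ ht'])
    · simp [shift_entry_right _ _ _ _ hs]
  · simp [shift_entry_left _ _ _ hr]

theorem shift_mul_eq_zero (g h h' k : ℕ ↪ ℕ) (hh : ∀ i j, h i ≠ h' j) (a b : FinMat A) :
    shift g h a * shift h' k b = 0 := by
  ext r s
  rw [mul_entry', zero_entry, ← finsum_zero (α := ℕ)]
  refine finsum_congr fun t => ?_
  by_cases ht : t ∈ Set.range h
  · have ht' : t ∉ Set.range h' := by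
      rintro ⟨j, hj⟩
      obtain ⟨i, hi⟩ := ht
      exact hh i j (hi.trans hj.symm)
    rw [shift_entry_left _ _ _ ht', mul_zero]
  · rw [shift_entry_right _ _ _ _ ht, zero_mul]

theorem shift_shift (g h g' h' : ℕ ↪ ℕ) (a : FinMat A) :
    shift g h (shift g' h' a) = shift (g'.trans g) (h'.trans h) a := by
  ext r s
  by_cases hr : r ∈ Set.range g
  · by_cases hs : s ∈ Set.range h
    · obtain ⟨i, rfl⟩ := hr
      obtain ⟨j, rfl⟩ := hs
      rw [shift_entry]
      by_cases hi : i ∈ Set.range g'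
      · by_cases hj : j ∈ Set.range h'
        · obtain ⟨i, rfl⟩ := hi
          obtain ⟨j, rfl⟩ := hj
          rw [shift_entry, ← Function.Embedding.trans_apply, ← Function.Embedding.trans_apply,
            shift_entry]
        · rw [shift_entry_right _ _ _ _ hj, shift_entry_right]
          rintro ⟨l, hl⟩
          exact hj ⟨l, h.injective hl⟩
      · rw [shift_entry_left _ _ _ hi, shift_entry_left]
        rintro ⟨l, hl⟩
        exact hi ⟨l, g.injective hl⟩
    · rw [shift_entry_right _ _ _ _ hs, shift_entry_right]
      rintro ⟨l, hl⟩
      exact hs ⟨_, hl⟩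
  · rw [shift_entry_left _ _ _ hr, shift_entry_left]
    rintro ⟨l, hl⟩
    exact hr ⟨_, hl⟩

theorem shift_smul (g h : ℕ ↪ ℕ) (c : ℂ) (a : FinMat A) :
    shift g h (c • a) = c • shift g h a := by
  ext r s
  rw [smul_entry]
  by_cases hr : r ∈ Set.range g
  · by_cases hs : s ∈ Set.range h
    · obtain ⟨i, rfl⟩ := hr
      obtain ⟨j, rfl⟩ := hs
      simp
    · rw [shift_entry_right _ _ _ _ hs, shift_entry_right _ _ _ _ hs, smul_zero]
  · rw [shift_entry_left _ _ _ hr, shift_entry_left _ _ _ hr, smul_zero]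

/-- Entrywise application of a ⋆-homomorphism. -/
def map {B : Type v} [NonUnitalCStarAlgebra B] (f : A →⋆ₙₐ[ℂ] B) :
    FinMat A →⋆ₙₐ[ℂ] FinMat B where
  toFun a := ⟨fun i j => f (a.entry i j), by
    obtain ⟨n, ha⟩ := a.exists_bound
    exact ⟨n, fun i j h => by rw [ha i j h, map_zero]⟩⟩
  map_smul' c a := by ext i j; simp
  map_zero' := by ext i j; simp
  map_add' a b := by ext i j; simp
  map_mul' a b := by
    obtain ⟨n, ha⟩ := a.exists_bound
    ext i j
    rw [mul_entry (n := n) (fun i j h => by simp [ha i j h])]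
    simp [mul_entry ha]
  map_star' a := by ext i j; simp [map_star]

@[simp] theorem map_entry {B : Type v} [NonUnitalCStarAlgebra B] (f : A →⋆ₙₐ[ℂ] B)
    (a : FinMat A) (i j : ℕ) : (map f a).entry i j = f (a.entry i j) := rfl

theorem map_shift {B : Type v} [NonUnitalCStarAlgebra B] (f : A →⋆ₙₐ[ℂ] B) (g h : ℕ ↪ ℕ)
    (a : FinMat A) : map f (shift g h a) = shift g h (map f a) := by
  ext r s
  by_cases hr : r ∈ Set.range g
  · by_cases hs : s ∈ Set.range h
    · obtain ⟨i, rfl⟩ := hr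
      obtain ⟨j, rfl⟩ := hs
      simp
    · simp [shift_entry_right _ _ _ _ hs]
  · simp [shift_entry_left _ _ _ hr]

end Shift

end FinMat

/-- The stabilization `A ⊗ 𝒦`, where `𝒦` is the algebra of compact operators on `ℓ²(ℕ)`: the
completion of the union of the matrix algebras `Mₙ(A)` in its C⋆-norm. -/
def Stabilization (A : Type u) [NonUnitalCStarAlgebra A] : Type u :=
  UniformSpace.Completion (FinMat A)

namespace Stabilization

open UniformSpace

variable {A : Type u} [NonUnitalCStarAlgebra A]

instance : NormedAddCommGroup (Stabilization A) :=
  inferInstanceAs (NormedAddCommGroup (Completion (FinMat A)))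

instance : NormedSpace ℂ (Stabilization A) :=
  inferInstanceAs (NormedSpace ℂ (Completion (FinMat A)))

instance : CompleteSpace (Stabilization A) :=
  inferInstanceAs (CompleteSpace (Completion (FinMat A)))

/-- The canonical inclusion of the union of the `Mₙ(A)`. -/
def of : FinMat A →ₗᵢ[ℂ] Stabilization A := Completion.toComplₗᵢ

theorem denseRange_of : DenseRange (of : FinMat A → Stabilization A) :=
  Completion.denseRange_coe

theorem isDenseInducing_of : IsDenseInducing (of : FinMat A → Stabilization A) :=
  Completion.isDenseInducing_coe

theorem continuous_of : Continuous (of : FinMat A → Stabilization A) := of.continuous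

theorem continuous_extend {D : Type v} [UniformSpace D] [CompleteSpace D] {f : FinMat A → D}
    (hf : UniformContinuous f) : Continuous (isDenseInducing_of.extend f) :=
  (uniformContinuous_uniformly_extend of.isometry.isUniformInducing denseRange_of
    hf).continuous

/-- The unique continuous extension of the matrix multiplication. -/
instance : Mul (Stabilization A) :=
  ⟨fun x y => (isDenseInducing_of.prodMap isDenseInducing_of).extend
    (fun p : FinMat A × FinMat A => of (p.1 * p.2)) (x, y)⟩

/-- The unique continuous extension of the adjoint. -/
instance : Star (Stabilization A) :=
  ⟨fun x => isDenseInducing_of.extend (fun a : FinMat A => of (star a)) x⟩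

theorem of_mul (a b : FinMat A) : of (a * b) = of a * of b :=
  ((isDenseInducing_of.prodMap isDenseInducing_of).extend_eq
    (continuous_of.comp continuous_mul) (a, b)).symm

theorem of_star (a : FinMat A) : of (star a) = star (of a) :=
  (isDenseInducing_of.extend_eq (continuous_of.comp continuous_star) a).symm

instance : ContinuousMul (Stabilization A) where
  continuous_mul := by
    let m := (AddMonoidHom.mul : FinMat A →+ FinMat A →+ FinMat A).compr₂
      (of : FinMat A →ₗᵢ[ℂ] Stabilization A).toLinearMap.toAddMonoidHom
    have hm : Continuous fun p : FinMat A × FinMat A => m p.1 p.2 :=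
      continuous_of.comp continuous_mul
    let i : FinMat A →+ Stabilization A :=
      (of : FinMat A →ₗᵢ[ℂ] Stabilization A).toLinearMap.toAddMonoidHom
    have di : IsDenseInducing i := isDenseInducing_of
    exact (di.extend_Z_bilin di hm :)

instance : ContinuousStar (Stabilization A) where
  continuous_star := by
    have h : LipschitzWith 1 (fun a : FinMat A => of (star a)) := by
      refine LipschitzWith.of_dist_le_mul fun a b => ?_
      simp only [dist_eq_norm, ← map_sub, ← star_sub, LinearIsometry.norm_map, norm_star,
        NNReal.coe_one, one_mul, le_refl]
    exact continuous_extend h.uniformContinuous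

@[elab_as_elim]
theorem induction₁ {P : Stabilization A → Prop} (x : Stabilization A)
    (hc : IsClosed {x | P x}) (h : ∀ a, P (of a)) : P x :=
  denseRange_of.induction_on x hc h

@[elab_as_elim]
theorem induction₂ {P : Stabilization A → Stabilization A → Prop} (x y : Stabilization A)
    (hc : IsClosed {p : Stabilization A × Stabilization A | P p.1 p.2})
    (h : ∀ a b, P (of a) (of b)) : P x y :=
  denseRange_of.induction_on₂ hc h x y

@[elab_as_elim]
theorem induction₃ {P : Stabilization A → Stabilization A → Stabilization A → Prop}
    (x y z : Stabilization A)
    (hc : IsClosed {p : Stabilization A × Stabilization A × Stabilization A | P p.1 p.2.1 p.2.2})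
    (h : ∀ a b c, P (of a) (of b) (of c)) : P x y z :=
  denseRange_of.induction_on₃ hc h x y z

instance : NonUnitalNormedRing (Stabilization A) where
  dist_eq := NormedAddCommGroup.dist_eq
  left_distrib x y z := induction₃ x y z (isClosed_eq (by fun_prop) (by fun_prop))
    fun a b c => by simp only [← map_add, ← of_mul, mul_add]
  right_distrib x y z := induction₃ x y z (isClosed_eq (by fun_prop) (by fun_prop))
    fun a b c => by simp only [← map_add, ← of_mul, add_mul]
  zero_mul x := induction₁ x (isClosed_eq (by fun_prop) (by fun_prop))
    fun a => by rw [← map_zero of, ← of_mul, zero_mul]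
  mul_zero x := induction₁ x (isClosed_eq (by fun_prop) (by fun_prop))
    fun a => by rw [← map_zero of, ← of_mul, mul_zero]
  mul_assoc x y z := induction₃ x y z (isClosed_eq (by fun_prop) (by fun_prop))
    fun a b c => by simp only [← of_mul, mul_assoc]
  norm_mul_le x y := induction₂ x y (isClosed_le (by fun_prop) (by fun_prop))
    fun a b => by
      simp only [← of_mul, LinearIsometry.norm_map]
      exact norm_mul_le a b

instance : StarRing (Stabilization A) where
  star_involutive x := induction₁ x (isClosed_eq (by fun_prop) (by fun_prop))
    fun a => by simp only [← of_star, star_star]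
  star_add x y := induction₂ x y (isClosed_eq (by fun_prop) (by fun_prop))
    fun a b => by simp only [← of_star, ← map_add, star_add]
  star_mul x y := induction₂ x y (isClosed_eq (by fun_prop) (by fun_prop))
    fun a b => by simp only [← of_star, ← of_mul, star_mul]

instance : CStarRing (Stabilization A) where
  norm_mul_self_le x := induction₁ x (isClosed_le (by fun_prop) (by fun_prop))
    fun a => by
      simp only [← of_star, ← of_mul, LinearIsometry.norm_map]
      exact CStarRing.norm_mul_self_le a

theorem continuous_smul_const (c : ℂ) : Continuous fun x : Stabilization A => c • x :=
  continuous_const_smul c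

instance : IsScalarTower ℂ (Stabilization A) (Stabilization A) where
  smul_assoc c x y := by
    change c • x * y = c • (x * y)
    refine induction₂ (P := fun x y => c • x * y = c • (x * y)) x y (isClosed_eq
      (((continuous_smul_const c).comp continuous_fst).mul continuous_snd)
      ((continuous_smul_const c).comp continuous_mul)) fun a b => ?_
    rw [← map_smul, ← of_mul, ← of_mul, ← map_smul, smul_mul_assoc]

instance : SMulCommClass ℂ (Stabilization A) (Stabilization A) where
  smul_comm c x y := by
    change c • (x * y) = x * c • y
    refine induction₂ (P := fun x y => c • (x * y) = x * c • y) x y (isClosed_eq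
      ((continuous_smul_const c).comp continuous_mul)
      (continuous_fst.mul ((continuous_smul_const c).comp continuous_snd))) fun a b => ?_
    rw [← map_smul, ← of_mul, ← of_mul, ← map_smul, mul_smul_comm]

instance : StarModule ℂ (Stabilization A) where
  star_smul c x := by
    refine induction₁ (P := fun x => star (c • x) = star c • star x) x (isClosed_eq
      (continuous_star.comp (continuous_smul_const c))
      ((continuous_smul_const (star c)).comp continuous_star)) fun a => ?_
    rw [← map_smul, ← of_star, ← of_star, ← map_smul, star_smul]

instance : NonUnitalCStarAlgebra (Stabilization A) where

/-- The inclusion of the union of the `Mₙ(A)`, as a ⋆-homomorphism. -/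
def ofHom : FinMat A →⋆ₙₐ[ℂ] Stabilization A where
  toFun := of
  map_smul' := map_smul of
  map_zero' := map_zero of
  map_add' := map_add of
  map_mul' := of_mul
  map_star' := of_star

section Lift

variable {D : Type v} [NonUnitalCStarAlgebra D]

theorem uniformContinuous_hom (φ : FinMat A →⋆ₙₐ[ℂ] D) : UniformContinuous φ :=
  (LipschitzWith.of_dist_le_mul (K := 1) fun a b => by
    simpa only [dist_eq_norm, ← map_sub, NNReal.coe_one, one_mul] using
      FinMat.norm_hom_le φ (a - b)).uniformContinuous

theorem continuous_extension (φ : FinMat A →⋆ₙₐ[ℂ] D) :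
    Continuous (isDenseInducing_of.extend φ) :=
  continuous_extend (uniformContinuous_hom φ)

theorem extension_of (φ : FinMat A →⋆ₙₐ[ℂ] D) (a : FinMat A) :
    isDenseInducing_of.extend φ (of a) = φ a :=
  isDenseInducing_of.extend_eq (uniformContinuous_hom φ).continuous a

/-- The extension by continuity of a ⋆-homomorphism. -/
def lift (φ : FinMat A →⋆ₙₐ[ℂ] D) : Stabilization A →⋆ₙₐ[ℂ] D where
  toFun x := isDenseInducing_of.extend φ x
  map_smul' c x := induction₁ x
    (isClosed_eq ((continuous_extension φ).comp (continuous_const_smul c))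
      ((continuous_extension φ).const_smul _))
    fun a => by
      rw [MonoidHom.id_apply, ← map_smul, extension_of, extension_of, map_smul]
  map_zero' := by rw [← map_zero of, extension_of, map_zero]
  map_add' x y := induction₂ x y
    (isClosed_eq ((continuous_extension φ).comp continuous_add)
      (((continuous_extension φ).comp continuous_fst).add
        ((continuous_extension φ).comp continuous_snd)))
    fun a b => by simp only [← map_add, extension_of]
  map_mul' x y := induction₂ x y
    (isClosed_eq ((continuous_extension φ).comp continuous_mul)
      (((continuous_extension φ).comp continuous_fst).mul
        ((continuous_extension φ).comp continuous_snd)))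
    fun a b => by simp only [← of_mul, extension_of, map_mul]
  map_star' x := induction₁ x
    (isClosed_eq ((continuous_extension φ).comp continuous_star) (continuous_extension φ).star)
    fun a => by simp only [← of_star, extension_of, map_star]

theorem lift_of (φ : FinMat A →⋆ₙₐ[ℂ] D) (a : FinMat A) : lift φ (of a) = φ a :=
  extension_of φ a

theorem continuous_lift (φ : FinMat A →⋆ₙₐ[ℂ] D) : Continuous (lift φ) :=
  continuous_extension φ

/-- The ⋆-homomorphism `f ⊗ id` from `A ⊗ 𝒦` to `D ⊗ 𝒦`. -/
def map (f : A →⋆ₙₐ[ℂ] D) : Stabilization A →⋆ₙₐ[ℂ] Stabilization D :=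
  lift (ofHom.comp (FinMat.map f))

theorem map_of (f : A →⋆ₙₐ[ℂ] D) (a : FinMat A) : map f (of a) = of (FinMat.map f a) :=
  lift_of _ a

end Lift

section Shift

/-- `FinMat.shift` for equal index maps is a ⋆-homomorphism. -/
def shiftHom (g : ℕ ↪ ℕ) : FinMat A →⋆ₙₐ[ℂ] Stabilization A where
  toFun a := of (FinMat.shift g g a)
  map_smul' c a := by
    rw [FinMat.shift_smul, map_smul]
    rfl
  map_zero' := by rw [map_zero, map_zero]
  map_add' a b := by rw [map_add, map_add]
  map_mul' a b := by rw [← FinMat.shift_mul g g g, of_mul]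
  map_star' a := by rw [FinMat.shift_star, of_star]

theorem norm_shift_le (g h : ℕ ↪ ℕ) (a : FinMat A) : ‖FinMat.shift g h a‖ ≤ ‖a‖ := by
  have h1 : ‖FinMat.shift g h a‖ * ‖FinMat.shift g h a‖ ≤ ‖a‖ * ‖a‖ := by
    rw [← CStarRing.norm_star_mul_self, ← CStarRing.norm_star_mul_self (x := a),
      ← FinMat.shift_star, FinMat.shift_mul]
    have := FinMat.norm_hom_le (shiftHom h) (star a * a)
    change ‖of (FinMat.shift h h (star a * a))‖ ≤ _ at this
    rwa [LinearIsometry.norm_map] at this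
  nlinarith [norm_nonneg (FinMat.shift g h a), norm_nonneg a]

theorem uniformContinuous_shift (g h : ℕ ↪ ℕ) :
    UniformContinuous (fun a : FinMat A => of (FinMat.shift g h a)) :=
  (LipschitzWith.of_dist_le_mul (K := 1) fun a b => by
    simpa only [dist_eq_norm, ← map_sub, NNReal.coe_one, one_mul, LinearIsometry.norm_map] using
      norm_shift_le g h (a - b)).uniformContinuous

/-- The continuous extension of `a ⊗ e_{ij} ↦ a ⊗ e_{g(i) h(j)}`. -/
def shift (g h : ℕ ↪ ℕ) (x : Stabilization A) : Stabilization A :=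
  isDenseInducing_of.extend (fun a : FinMat A => of (FinMat.shift g h a)) x

@[fun_prop] theorem continuous_shift (g h : ℕ ↪ ℕ) :
    Continuous (shift g h : Stabilization A → Stabilization A) :=
  continuous_extend (uniformContinuous_shift g h)

theorem shift_of (g h : ℕ ↪ ℕ) (a : FinMat A) : shift g h (of a) = of (FinMat.shift g h a) :=
  isDenseInducing_of.extend_eq (uniformContinuous_shift g h).continuous a

theorem shift_add (g h : ℕ ↪ ℕ) (x y : Stabilization A) :
    shift g h (x + y) = shift g h x + shift g h y :=
  induction₂ x y (isClosed_eq (by fun_prop) (by fun_prop))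
    fun a b => by simp only [shift_of, ← map_add]

theorem shift_zero (g h : ℕ ↪ ℕ) : shift g h (0 : Stabilization A) = 0 := by
  rw [← map_zero of, shift_of, map_zero]

theorem shift_star (g h : ℕ ↪ ℕ) (x : Stabilization A) :
    shift h g (star x) = star (shift g h x) :=
  induction₁ x (isClosed_eq (by fun_prop) (by fun_prop))
    fun a => by simp only [shift_of, ← of_star, FinMat.shift_star]

theorem shift_mul (g h k : ℕ ↪ ℕ) (x y : Stabilization A) :
    shift g h x * shift h k y = shift g k (x * y) :=
  induction₂ x y (isClosed_eq (by fun_prop) (by fun_prop))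
    fun a b => by simp only [shift_of, ← of_mul, FinMat.shift_mul]

theorem shift_mul_eq_zero (g h h' k : ℕ ↪ ℕ) (hh : ∀ i j, h i ≠ h' j) (x y : Stabilization A) :
    shift g h x * shift h' k y = 0 :=
  induction₂ x y (isClosed_eq (by fun_prop) (by fun_prop))
    fun a b => by simp only [shift_of, ← of_mul, FinMat.shift_mul_eq_zero g h h' k hh, map_zero]

theorem shift_shift (g h g' h' : ℕ ↪ ℕ) (x : Stabilization A) :
    shift g h (shift g' h' x) = shift (g'.trans g) (h'.trans h) x :=
  induction₁ x (isClosed_eq (by fun_prop) (by fun_prop))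
    fun a => by simp only [shift_of, FinMat.shift_shift]

theorem shift_refl (x : Stabilization A) :
    shift (Function.Embedding.refl ℕ) (Function.Embedding.refl ℕ) x = x :=
  induction₁ x (isClosed_eq (by fun_prop) (by fun_prop))
    fun a => by
      rw [shift_of]
      congr 1
      ext i j
      exact FinMat.shift_entry (Function.Embedding.refl ℕ) (Function.Embedding.refl ℕ) a i j

theorem map_shift {D : Type v} [NonUnitalCStarAlgebra D] (f : A →⋆ₙₐ[ℂ] D) (g h : ℕ ↪ ℕ)
    (x : Stabilization A) : map f (shift g h x) = shift g h (map f x) :=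
  induction₁ x (isClosed_eq ((continuous_lift _).comp (continuous_shift g h))
    ((continuous_shift g h).comp (continuous_lift _)))
    fun a => by simp only [shift_of, map_of, FinMat.map_shift]

end Shift

end Stabilization

section Projections

variable {D : Type u} [NonUnitalCStarAlgebra D]

/-- Murray–von Neumann equivalence. -/
def MvNEquiv (p q : D) : Prop := ∃ x : D, star x * x = p ∧ x * star x = q

/-- `p` is a sub-projection of `q` (for projections `p` and `q`). -/
def IsSubproj (p q : D) : Prop := q * p = p

/-- `p` is Murray–von Neumann equivalent to a sub-projection of `q`. -/
def MvNSub (p q : D) : Prop := ∃ p' : D, IsStarProjection p' ∧ MvNEquiv p p' ∧ IsSubproj p' q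

/-- A projection that is equivalent to a proper sub-projection of itself. -/
def IsInfiniteProjection (p : D) : Prop :=
  IsStarProjection p ∧ ∃ q : D, IsStarProjection q ∧ IsSubproj q p ∧ q ≠ p ∧ MvNEquiv p q

theorem MvNEquiv.refl {p : D} (hp : IsStarProjection p) : MvNEquiv p p :=
  ⟨p, by rw [hp.isSelfAdjoint.star_eq, hp.isIdempotentElem.eq],
    by rw [hp.isSelfAdjoint.star_eq, hp.isIdempotentElem.eq]⟩

theorem MvNEquiv.symm {p q : D} (h : MvNEquiv p q) : MvNEquiv q p := by
  obtain ⟨x, h1, h2⟩ := h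
  exact ⟨star x, by rw [star_star, h2], by rw [star_star, h1]⟩

theorem MvNEquiv.trans {p q r : D} (hp : IsStarProjection p) (hr : IsStarProjection r)
    (h : MvNEquiv p q) (h' : MvNEquiv q r) : MvNEquiv p r := by
  obtain ⟨x, h1, h2⟩ := h
  obtain ⟨y, h3, h4⟩ := h'
  refine ⟨y * x, ?_, ?_⟩
  · calc star (y * x) * (y * x) = star x * (star y * y) * x := by simp only [star_mul, mul_assoc]
      _ = (star x * x) * (star x * x) := by rw [h3, ← h2]; simp only [mul_assoc]
      _ = p := by rw [h1, hp.isIdempotentElem.eq]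
  · calc y * x * star (y * x) = y * (x * star x) * star y := by simp only [star_mul, mul_assoc]
      _ = (y * star y) * (y * star y) := by rw [h2, ← h3]; simp only [mul_assoc]
      _ = r := by rw [h4, hr.isIdempotentElem.eq]

theorem MvNEquiv.sub {p q : D} (hq : IsStarProjection q) (h : MvNEquiv p q) : MvNSub p q :=
  ⟨q, hq, h, hq.isIdempotentElem.eq⟩

theorem MvNSub.trans {p q r : D} (hp : IsStarProjection p) (h : MvNSub p q) (h' : MvNSub q r) :
    MvNSub p r := by
  obtain ⟨p', hp', hpp', hsub⟩ := h
  obtain ⟨q', hq', ⟨y, hy1, hy2⟩, hsub'⟩ := h'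
  have e1 : star y * y * p' = p' := by rw [hy1]; exact hsub
  have e2 : y * p' * star y * (y * p' * star y) = y * p' * star y := by
    calc y * p' * star y * (y * p' * star y) = y * p' * (star y * y * p') * star y := by
          simp only [mul_assoc]
      _ = y * (p' * p') * star y := by rw [e1]; simp only [mul_assoc]
      _ = y * p' * star y := by rw [hp'.isIdempotentElem.eq]
  have e3 : IsStarProjection (y * p' * star y) := by
    refine ⟨e2, ?_⟩
    simp only [IsSelfAdjoint, star_mul, star_star, hp'.isSelfAdjoint.star_eq, mul_assoc]
  refine ⟨y * p' * star y, e3, hpp'.trans hp e3 ⟨y * p', ?_, ?_⟩, ?_⟩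
  · calc star (y * p') * (y * p') = p' * (star y * y * p') := by
          simp only [star_mul, hp'.isSelfAdjoint.star_eq, mul_assoc]
      _ = p' := by rw [e1, hp'.isIdempotentElem.eq]
  · calc y * p' * star (y * p') = y * (p' * p') * star y := by
          simp only [star_mul, hp'.isSelfAdjoint.star_eq, mul_assoc]
      _ = y * p' * star y := by rw [hp'.isIdempotentElem.eq]
  · have e4 : q' * (y * p' * star y) = y * p' * star y := by
      calc q' * (y * p' * star y) = y * (star y * y * p') * star y := by
            rw [← hy2]; simp only [mul_assoc]
        _ = y * p' * star y := by rw [e1]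
    calc r * (y * p' * star y) = r * q' * (y * p' * star y) := by rw [mul_assoc r q', e4]
      _ = y * p' * star y := by rw [show r * q' = q' from hsub', e4]

theorem MvNEquiv.map {D' : Type v} [NonUnitalCStarAlgebra D'] (f : D →⋆ₙₐ[ℂ] D') {p q : D}
    (h : MvNEquiv p q) : MvNEquiv (f p) (f q) := by
  obtain ⟨x, rfl, rfl⟩ := h
  exact ⟨f x, by rw [map_mul, map_star], by rw [map_mul, map_star]⟩

theorem MvNSub.map {D' : Type v} [NonUnitalCStarAlgebra D'] (f : D →⋆ₙₐ[ℂ] D') {p q : D}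
    (h : MvNSub p q) : MvNSub (f p) (f q) := by
  obtain ⟨p', hp', h1, h2⟩ := h
  exact ⟨f p', hp'.map f, h1.map f, by rw [IsSubproj, ← map_mul, show q * p' = p' from h2]⟩

end Projections

/-- A C⋆-algebra is infinite if it contains an infinite projection. -/
def IsInfiniteCStar (A : Type u) [NonUnitalCStarAlgebra A] : Prop :=
  ∃ p : A, IsInfiniteProjection p

/-- Murray–von Neumann equivalence as an equivalence relation on the projections of `D`. -/
def mvnSetoid (D : Type u) [NonUnitalCStarAlgebra D] : Setoid {p : D // IsStarProjection p} where
  r p q := MvNEquiv p.1 q.1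
  iseqv := ⟨fun p => .refl p.2, fun h => h.symm, fun {p _ r} h h' => h.trans p.2 r.2 h'⟩

/-- The Murray–von Neumann semigroup `V(A)`: equivalence classes of projections in `A ⊗ 𝒦`. -/
def VSemigroup (A : Type u) [NonUnitalCStarAlgebra A] : Type u :=
  Quotient (mvnSetoid (Stabilization A))

namespace VSemigroup

variable {A : Type u} [NonUnitalCStarAlgebra A]

/-- The class of a projection. -/
def mk (p : Stabilization A) (hp : IsStarProjection p) : VSemigroup A :=
  Quotient.mk (mvnSetoid (Stabilization A)) ⟨p, hp⟩

theorem mk_eq_mk {p q : Stabilization A} {hp : IsStarProjection p} {hq : IsStarProjection q} :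
    mk p hp = mk q hq ↔ MvNEquiv p q :=
  Quotient.eq (r := mvnSetoid (Stabilization A))

theorem ind {P : VSemigroup A → Prop} (h : ∀ p hp, P (mk p hp)) (x : VSemigroup A) : P x :=
  Quotient.ind (fun p => h p.1 p.2) x

/-- `i ↦ 2 i`. -/
def evenEmb : ℕ ↪ ℕ := ⟨fun i => 2 * i, fun i j h => by simpa using h⟩

/-- `i ↦ 2 i + 1`. -/
def oddEmb : ℕ ↪ ℕ := ⟨fun i => 2 * i + 1, fun i j h => by simpa using h⟩

theorem even_ne_odd (i j : ℕ) : evenEmb i ≠ oddEmb j := by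
  change 2 * i ≠ 2 * j + 1
  omega

open Stabilization

/-- The orthogonal direct sum `x ⊕ y = diag(x, y)`, under the identification of `M₂(A ⊗ 𝒦)` with
`A ⊗ 𝒦` that comes from splitting `ℕ` into the even and the odd numbers. -/
def dsum (x y : Stabilization A) : Stabilization A :=
  shift evenEmb evenEmb x + shift oddEmb oddEmb y

theorem dsum_mul (x y x' y' : Stabilization A) :
    dsum x y * dsum x' y' = dsum (x * x') (y * y') := by
  simp only [dsum, mul_add, add_mul, shift_mul,
    shift_mul_eq_zero _ _ _ _ even_ne_odd, shift_mul_eq_zero _ _ _ _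
      (fun i j => (even_ne_odd j i).symm), add_zero, zero_add]

theorem dsum_star (x y : Stabilization A) : star (dsum x y) = dsum (star x) (star y) := by
  simp only [dsum, star_add, shift_star]

theorem isStarProjection_dsum {p q : Stabilization A} (hp : IsStarProjection p)
    (hq : IsStarProjection q) : IsStarProjection (dsum p q) :=
  ⟨by rw [IsIdempotentElem, dsum_mul, hp.isIdempotentElem.eq, hq.isIdempotentElem.eq],
    by rw [IsSelfAdjoint, dsum_star, hp.isSelfAdjoint.star_eq, hq.isSelfAdjoint.star_eq]⟩

theorem mvnEquiv_dsum {p q p' q' : Stabilization A} (h : MvNEquiv p p') (h' : MvNEquiv q q') :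
    MvNEquiv (dsum p q) (dsum p' q') := by
  obtain ⟨x, rfl, rfl⟩ := h
  obtain ⟨y, rfl, rfl⟩ := h'
  exact ⟨dsum x y, by rw [dsum_star, dsum_mul], by rw [dsum_star, dsum_mul]⟩

theorem mvnSub_dsum {p q p' q' : Stabilization A} (h : MvNSub p p') (h' : MvNSub q q') :
    MvNSub (dsum p q) (dsum p' q') := by
  obtain ⟨r, hr, h1, h2⟩ := h
  obtain ⟨s, hs, h3, h4⟩ := h'
  exact ⟨dsum r s, isStarProjection_dsum hr hs, mvnEquiv_dsum h1 h3,
    by rw [IsSubproj, dsum_mul, show p' * r = r from h2, show q' * s = s from h4]⟩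

theorem mvnEquiv_shift {p : Stabilization A} (hp : IsStarProjection p) (g : ℕ ↪ ℕ) :
    MvNEquiv (shift g g p) p := by
  refine ⟨shift (Function.Embedding.refl ℕ) g p, ?_, ?_⟩
  · rw [← shift_star, shift_mul, hp.isSelfAdjoint.star_eq, hp.isIdempotentElem.eq]
  · rw [← shift_star, shift_mul, hp.isSelfAdjoint.star_eq, hp.isIdempotentElem.eq, shift_refl]

instance : Zero (VSemigroup A) := ⟨mk 0 (.zero _)⟩

/-- `[p] + [q] = [p ⊕ q]`. -/
instance : Add (VSemigroup A) :=
  ⟨Quotient.map₂ (sa := mvnSetoid _) (sb := mvnSetoid _) (sc := mvnSetoid _)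
    (fun p q => ⟨dsum p.1 q.1, isStarProjection_dsum p.2 q.2⟩)
    (fun _ _ h _ _ h' => mvnEquiv_dsum h h')⟩

/-- `[p] ≤ [q]` if `p` is equivalent to a sub-projection of `q`. -/
instance : LE (VSemigroup A) :=
  ⟨Quotient.lift₂ (s₁ := mvnSetoid _) (s₂ := mvnSetoid _) (fun p q => MvNSub p.1 q.1)
    (fun p q p' q' h h' => propext
      ⟨fun H => ((MvNEquiv.symm h).sub p.2).trans p'.2 (H.trans p.2 (MvNEquiv.sub q'.2 h')),
        fun H => (MvNEquiv.sub p'.2 h).trans p.2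
          (H.trans p'.2 ((MvNEquiv.symm h').sub q.2))⟩)⟩

theorem mk_add_mk {p q : Stabilization A} (hp : IsStarProjection p) (hq : IsStarProjection q) :
    mk p hp + mk q hq = mk (dsum p q) (isStarProjection_dsum hp hq) := rfl

theorem mk_le_mk {p q : Stabilization A} {hp : IsStarProjection p} {hq : IsStarProjection q} :
    mk p hp ≤ mk q hq ↔ MvNSub p q := Iff.rfl

instance : Preorder (VSemigroup A) where
  le_refl := ind fun _ hp => (MvNEquiv.refl hp).sub hp
  le_trans := ind fun _ hp => ind fun _ _ => ind fun _ _ h h' => MvNSub.trans hp h h'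

instance : AddCommMonoid (VSemigroup A) where
  nsmul := nsmulRec
  add_comm := ind fun p hp => ind fun q hq => by
    rw [mk_add_mk, mk_add_mk, mk_eq_mk]
    refine ⟨shift oddEmb evenEmb p + shift evenEmb oddEmb q, ?_, ?_⟩ <;>
    simp only [dsum, star_add, ← shift_star, mul_add, add_mul, shift_mul,
      shift_mul_eq_zero _ _ _ _ even_ne_odd, shift_mul_eq_zero _ _ _ _
        (fun i j => (even_ne_odd j i).symm), add_zero, zero_add, hp.isSelfAdjoint.star_eq,
      hq.isSelfAdjoint.star_eq, hp.isIdempotentElem.eq, hq.isIdempotentElem.eq]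
    exact add_comm _ _
  zero_add := ind fun p hp => by
    change mk (dsum 0 p) _ = _
    rw [mk_eq_mk, dsum, shift_zero, zero_add]
    exact mvnEquiv_shift hp oddEmb
  add_zero := ind fun p hp => by
    change mk (dsum p 0) _ = _
    rw [mk_eq_mk, dsum, shift_zero, add_zero]
    exact mvnEquiv_shift hp evenEmb
  add_assoc := ind fun p hp => ind fun q hq => ind fun r hr => by
    simp only [mk_add_mk]
    rw [mk_eq_mk]
    refine ⟨shift evenEmb (evenEmb.trans evenEmb) p +
      shift (evenEmb.trans oddEmb) (oddEmb.trans evenEmb) q +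
      shift (oddEmb.trans oddEmb) oddEmb r, ?_, ?_⟩
    · have h1 : ∀ i j, evenEmb i ≠ (evenEmb.trans oddEmb) j := fun i j => even_ne_odd _ _
      have h2 : ∀ i j, evenEmb i ≠ (oddEmb.trans oddEmb) j := fun i j => even_ne_odd _ _
      have h3 : ∀ i j, (evenEmb.trans oddEmb) i ≠ (oddEmb.trans oddEmb) j := fun i j h =>
        even_ne_odd _ _ (oddEmb.injective h)
      simp only [dsum, star_add, ← shift_star, mul_add, add_mul, shift_mul, shift_add, shift_shift,
        shift_mul_eq_zero _ _ _ _ h1, shift_mul_eq_zero _ _ _ _ h2, shift_mul_eq_zero _ _ _ _ h3,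
        shift_mul_eq_zero _ _ _ _ (fun i j => (h1 j i).symm),
        shift_mul_eq_zero _ _ _ _ (fun i j => (h2 j i).symm),
        shift_mul_eq_zero _ _ _ _ (fun i j => (h3 j i).symm), add_zero, zero_add,
        hp.isSelfAdjoint.star_eq, hq.isSelfAdjoint.star_eq, hr.isSelfAdjoint.star_eq,
        hp.isIdempotentElem.eq, hq.isIdempotentElem.eq, hr.isIdempotentElem.eq]
    · have h1 : ∀ i j, (evenEmb.trans evenEmb) i ≠ (oddEmb.trans evenEmb) j := fun i j h =>
        even_ne_odd _ _ (evenEmb.injective h)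
      have h2 : ∀ i j, (evenEmb.trans evenEmb) i ≠ oddEmb j := fun i j => even_ne_odd _ _
      have h3 : ∀ i j, (oddEmb.trans evenEmb) i ≠ oddEmb j := fun i j => even_ne_odd _ _
      simp only [dsum, star_add, ← shift_star, mul_add, add_mul, shift_mul, shift_add, shift_shift,
        shift_mul_eq_zero _ _ _ _ h1, shift_mul_eq_zero _ _ _ _ h2, shift_mul_eq_zero _ _ _ _ h3,
        shift_mul_eq_zero _ _ _ _ (fun i j => (h1 j i).symm),
        shift_mul_eq_zero _ _ _ _ (fun i j => (h2 j i).symm),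
        shift_mul_eq_zero _ _ _ _ (fun i j => (h3 j i).symm), add_zero, zero_add,
        hp.isSelfAdjoint.star_eq, hq.isSelfAdjoint.star_eq, hr.isSelfAdjoint.star_eq,
        hp.isIdempotentElem.eq, hq.isIdempotentElem.eq, hr.isIdempotentElem.eq]
      exact add_assoc _ _ _

instance : IsOrderedAddMonoid (VSemigroup A) where
  add_le_add_left x y := by
    revert x y
    exact ind fun p hp => ind fun q hq h => ind fun r hr =>
      mvnSub_dsum h ((MvNEquiv.refl hr).sub hr)

/-- The morphism of pre-ordered monoids `V(f) : V(A) → V(B)`, `[p] ↦ [(f ⊗ id)(p)]`. -/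
def map {B : Type v} [NonUnitalCStarAlgebra B] (f : A →⋆ₙₐ[ℂ] B) :
    VSemigroup A →+o VSemigroup B where
  toFun := Quotient.map (sa := mvnSetoid _) (sb := mvnSetoid _)
    (fun p => ⟨Stabilization.map f p.1, p.2.map _⟩) (fun _ _ h => h.map _)
  map_zero' := by
    change mk (Stabilization.map f 0) _ = mk 0 _
    simp only [map_zero]
  map_add' := ind fun p hp => ind fun q hq => by
    change mk (Stabilization.map f (dsum p q)) _ =
      mk (dsum (Stabilization.map f p) (Stabilization.map f q)) _
    simp only [dsum, map_add, map_shift]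
  monotone' := ind fun p hp => ind fun q hq h => MvNSub.map (Stabilization.map f) h

theorem map_mk {B : Type v} [NonUnitalCStarAlgebra B] (f : A →⋆ₙₐ[ℂ] B)
    {p : Stabilization A} (hp : IsStarProjection p) :
    map f (mk p hp) = mk (Stabilization.map f p) (hp.map _) := rfl

end VSemigroup

/-- `A` is stable: `A ≅ A ⊗ 𝒦`. -/
def IsStable (A : Type u) [NonUnitalCStarAlgebra A] : Prop :=
  Nonempty (A ≃⋆ₐ[ℂ] Stabilization A)

/-- Real rank zero, for a unital C⋆-algebra: the invertible self-adjoint elements are dense in the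
self-adjoint elements. -/
def RealRankZeroUnital (A : Type u) [CStarAlgebra A] : Prop :=
  {a : A | IsSelfAdjoint a} ⊆ closure {a : A | IsSelfAdjoint a ∧ IsUnit a}

/-- Real rank zero, for a possibly non-unital C⋆-algebra: the unitization has real rank zero.
(If `A` has a unit, then `Unitization ℂ A ≅ A ⊕ ℂ`, which has real rank zero if and only if `A`
has.) -/
def RealRankZero (A : Type u) [NonUnitalCStarAlgebra A] : Prop :=
  RealRankZeroUnital (Unitization ℂ A)

/-- `0 → B → E → A → 0` is an extension of C⋆-algebras. -/
structure IsCStarExtension {B : Type u} {E : Type v} {A : Type w} [NonUnitalCStarAlgebra B]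
    [NonUnitalCStarAlgebra E] [NonUnitalCStarAlgebra A] (ι : B →⋆ₙₐ[ℂ] E) (π : E →⋆ₙₐ[ℂ] A) :
    Prop where
  injective : Function.Injective ι
  exact : Function.Exact ι π
  surjective : Function.Surjective π

end

noncomputable section

universe u v w

/-! ### Projections and partial isometries in unital algebras of real rank zero -/

section Unital

attribute [local instance] CStarAlgebra.spectralOrder CStarAlgebra.spectralOrderedRing

variable {U : Type u} [CStarAlgebra U] {W : Type v} [CStarAlgebra W]

/-! When `E` is stable and of real rank zero, `V(A)` can be read off from `V(E)` and the image of
`V(B)`: `V(π)` is surjective (`map_surjective_of_realRankZero`), its kernel is the range of `V(ι)`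
(`map_eq_zero_iff`), and two classes of `V(E)` have the same image exactly when they become equal
after adding classes from `V(B)` (`map_eq_map_iff`). As `A` is stable, infiniteness of `A` is a
statement about `V(A)`: some class absorbs a nonzero class (`isInfiniteCStar_stabilization_iff`).
Pulled back to `V(E)` it reads `x + z + V(ι)(b) = x + V(ι)(c)` with `z` outside the range of `V(ι)`.
An isomorphism `V(E₁) ≅ V(E₂)` that matches the images of `V(B₁)` and `V(B₂)` preserves this
condition.

The analytic work is in two lifting results for surjections from algebras of real rank zero:
projections lift up to equivalence, and an equivalence of images comes from an equivalence of
sub-projections that have the same images. Both use one device. A self-adjoint lift `h` of a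
projection is rescaled to `4h - 2` (with the unit of a corner in place of `1` where needed) and
moved by less than `1` to an invertible self-adjoint element. Compressed by the positive spectral
projection of that element, `h` is at least `1/4`; compressed by the complementary one, it is at
most `3/4`. These crude bounds suffice, because polar decomposition (`exists_polar`) turns
invertibility in a corner into an exact partial isometry.

That `⊗ 𝒦` preserves exactness follows from lifting elements along ⋆-homomorphisms with control of
the norm (`exists_norm_le_two_mul`). -/

theorem isSelfAdjoint_units_inv {k : Uˣ} (h : IsSelfAdjoint (k : U)) :
    IsSelfAdjoint (↑k⁻¹ : U) := by
  have h1 : IsSelfAdjoint k := Units.ext (by simpa using h.star_eq)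
  have h2 := congrArg Units.val h1.inv.star_eq
  rwa [Units.coe_star] at h2

/-- Polar decomposition of an element `w` for which `w⋆ w` is invertible in the corner of `r`. -/
theorem exists_polar {w r : U} (hr : IsStarProjection r) (hw : w * r = w)
    (hu : IsUnit (star w * w + (1 - r))) :
    ∃ g : U, IsSelfAdjoint g ∧ Commute g r ∧ g * g * (star w * w + (1 - r)) = 1 ∧
      star (w * g) * (w * g) = r := by
  have hr2 := hr.isIdempotentElem.eq
  have hws : r * star w = star w := by
    have := congrArg star hw
    rwa [star_mul, hr.isSelfAdjoint.star_eq] at this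
  -- Adding `1 - r` makes the corner element `w⋆ w` invertible in the whole algebra without changing
  -- it on the corner; `g` is `m^(-1/2)`, that is, the inverse of `|w|` in the corner and `1` on the
  -- complement.
  set m := star w * w + (1 - r) with hm
  have hm0 : 0 ≤ m := add_nonneg (star_mul_self_nonneg w) hr.one_sub.nonneg
  have hmr : Commute m r := by
    change m * r = r * m
    rw [hm, add_mul, mul_add, mul_assoc, hw, ← mul_assoc r, hws, sub_mul, mul_sub, one_mul, mul_one]
  set h := CFC.sqrt m with hh
  have hhh : h * h = m := CFC.sqrt_mul_sqrt_self m
  have hhr : Commute h r := by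
    rw [hh, CFC.sqrt_eq_cfc]
    exact hmr.cfc_nnreal _
  have hhs : IsSelfAdjoint h := (CFC.sqrt_nonneg m).isSelfAdjoint
  have hhu : IsUnit h := by
    rw [← hhh] at hu
    exact ((Commute.refl h).isUnit_mul_iff.1 hu).1
  obtain ⟨k, hk⟩ := hhu
  have hgs : IsSelfAdjoint (↑k⁻¹ : U) := isSelfAdjoint_units_inv (hk ▸ hhs)
  have hgr : Commute (↑k⁻¹ : U) r := by
    rw [← hk] at hhr
    exact hhr.units_inv_left
  have hg2 : (↑k⁻¹ : U) * ↑k⁻¹ * m = 1 := by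
    rw [← hhh, ← hk]; simp [mul_assoc]
  refine ⟨↑k⁻¹, hgs, hgr, hg2, ?_⟩
  have e4 : star w * w = m * r := by
    rw [hm, add_mul, mul_assoc, hw, sub_mul, hr2, one_mul, sub_self, add_zero]
  have e5 : r * (↑k⁻¹ : U) = ↑k⁻¹ * r := hgr.eq.symm
  have e6 : (↑k⁻¹ : U) * m = m * ↑k⁻¹ := by
    rw [← hhh, ← hk]; simp [← mul_assoc]
  calc star (w * ↑k⁻¹) * (w * ↑k⁻¹) = ↑k⁻¹ * (star w * w) * ↑k⁻¹ := by
        rw [star_mul, hgs.star_eq]; simp only [mul_assoc]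
    _ = ↑k⁻¹ * m * ↑k⁻¹ * r := by rw [e4, mul_assoc, mul_assoc m, e5]; simp only [mul_assoc]
    _ = ↑k⁻¹ * ↑k⁻¹ * m * r := by rw [mul_assoc _ m, ← e6]; simp only [mul_assoc]
    _ = r := by rw [hg2, one_mul]

/-- The spectral projection of an invertible self-adjoint element for the positive half-line. -/
theorem exists_spectralProjection {b : U} (hb : IsSelfAdjoint b) (hu : IsUnit b) :
    ∃ e : U, IsStarProjection e ∧ (∀ c, Commute b c → Commute e c) ∧ 0 ≤ e * b ∧
      (1 - e) * b ≤ 0 := by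
  have h0 : ∀ t ∈ spectrum ℝ b, t ≠ 0 := fun t ht h => by
    subst h
    exact spectrum.zero_notMem ℝ hu ht
  -- Invertibility keeps `0`, the only discontinuity of the indicator function, out of the spectrum.
  have hc : ContinuousOn (fun t : ℝ => if 0 < t then (1 : ℝ) else 0) (spectrum ℝ b) := by
    intro t ht
    refine ContinuousAt.continuousWithinAt ?_
    rcases (h0 t ht).lt_or_gt with h | h
    · refine (continuousAt_const (y := (0 : ℝ))).congr ?_
      filter_upwards [gt_mem_nhds h] with s hs
      rw [if_neg hs.not_gt]
    · refine (continuousAt_const (y := (1 : ℝ))).congr ?_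
      filter_upwards [lt_mem_nhds h] with s hs
      rw [if_pos hs]
  refine ⟨cfc (fun t : ℝ => if 0 < t then (1 : ℝ) else 0) b, ⟨?_, cfc_predicate _ _⟩,
    fun c hbc => hbc.cfc_real _, ?_, ?_⟩
  · rw [IsIdempotentElem, ← cfc_mul _ _ b hc hc]
    exact cfc_congr fun t _ => by split_ifs <;> simp
  · have : cfc (fun t : ℝ => (if 0 < t then (1 : ℝ) else 0) * t) b =
        cfc (fun t : ℝ => if 0 < t then (1 : ℝ) else 0) b * b := by
      rw [cfc_mul _ _ b hc (by fun_prop), cfc_id' ℝ b]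
    rw [← this]
    refine cfc_nonneg fun t _ => ?_
    split_ifs with h
    · simpa using h.le
    · simp
  · have : cfc (fun t : ℝ => (1 - if 0 < t then (1 : ℝ) else 0) * t) b =
        (1 - cfc (fun t : ℝ => if 0 < t then (1 : ℝ) else 0) b) * b := by
      rw [cfc_mul _ _ b (by fun_prop) (by fun_prop), cfc_sub _ _ b (by fun_prop) hc,
        cfc_const_one ℝ b, cfc_id' ℝ b]
    rw [← this]
    refine cfc_nonpos _ _ fun t _ => ?_
    split_ifs with h
    · simp
    · simpa using not_lt.1 h

/-- Corners of algebras of real rank zero have real rank zero. -/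
theorem RealRankZeroUnital.exists_isUnit_corner (hU : RealRankZeroUnital U) {p a : U}
    (hp : IsStarProjection p) (ha : IsSelfAdjoint a) (hpa : p * a = a) {ε : ℝ} (hε : 0 < ε) :
    ∃ y : U, IsSelfAdjoint y ∧ p * y = y ∧ y * p = y ∧ IsUnit (y + (1 - p)) ∧ ‖y - a‖ < ε := by
  have hp2 : p * p = p := hp.isIdempotentElem.eq
  have hps : star p = p := hp.isSelfAdjoint.star_eq
  have hap : a * p = a := by
    have := congrArg star hpa
    rwa [star_mul, hps, ha.star_eq] at this
  obtain ⟨q, hq⟩ : ∃ q, q = 1 - p := ⟨_, rfl⟩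
  have hqproj : IsStarProjection q := hq ▸ hp.one_sub
  have hq2 : q * q = q := hqproj.isIdempotentElem.eq
  have hqs : star q = q := hqproj.isSelfAdjoint.star_eq
  have hpq : p * q = 0 := by rw [hq, mul_sub, mul_one, hp2, sub_self]
  have hqp : q * p = 0 := by rw [hq, sub_mul, one_mul, hp2, sub_self]
  have hpq1 : p + q = 1 := by rw [hq]; abel
  have hqa : q * a = 0 := by rw [← hpa, ← mul_assoc, hqp, zero_mul]
  have haq : a * q = 0 := by rw [← hap, mul_assoc, hpq, mul_zero]
  -- With `δ < 1/2` the `q`-block of the approximant is invertible with inverse of norm at most `2`,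
  -- and the final error `δ + 2δ²` is at most `2δ < ε`.
  have hδ : 0 < min (1 / 2) (ε / 2) := by positivity
  obtain ⟨b, ⟨hbs, β, rfl⟩, hb⟩ := Metric.mem_closure_iff.1
    (hU (show IsSelfAdjoint (a + q) from ha.add hqproj.isSelfAdjoint)) _ hδ
  obtain ⟨b, hbβ⟩ : ∃ b : U, b = β := ⟨_, rfl⟩
  rw [← hbβ] at hbs hb
  obtain ⟨d, hd⟩ : ∃ d, d = b - (a + q) := ⟨_, rfl⟩
  obtain ⟨δ, hδe⟩ : ∃ δ, δ = ‖d‖ := ⟨_, rfl⟩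
  rw [dist_comm, dist_eq_norm, ← hd, ← hδe, lt_min_iff] at hb
  have hδ0 : 0 ≤ δ := hδe ▸ norm_nonneg d
  have hp1 : ‖p‖ ≤ 1 := hp.norm_le
  have hq1 : ‖q‖ ≤ 1 := hqproj.norm_le
  have hcut : ∀ c c' : U, ‖c‖ ≤ 1 → ‖c'‖ ≤ 1 → ‖c * d * c'‖ ≤ δ := fun c c' h h' =>
    calc ‖c * d * c'‖ ≤ ‖c‖ * ‖d‖ * ‖c'‖ :=
          (norm_mul_le _ _).trans (mul_le_mul_of_nonneg_right (norm_mul_le _ _) (norm_nonneg _))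
      _ ≤ 1 * ‖d‖ * 1 := by gcongr
      _ = δ := by rw [hδe]; ring
  -- Since `a + q` is block diagonal for `p + q = 1`, every block of `b` differs from the expected
  -- one (`a`, `q` or zero) by a block of the small element `d`.
  have hqbq : q * b * q + p - 1 = q * d * q := by
    rw [hd, mul_sub, sub_mul, mul_add, hqa, zero_add, hq2, hq2, ← hpq1]; abel
  have hpbp : p * b * p - a = p * d * p := by
    rw [hd, mul_sub, sub_mul, mul_add, hpa, hpq, add_zero, hap]
  have hpbq : p * b * q = p * d * q := by
    rw [hd, mul_sub, sub_mul, mul_add, hpa, hpq, add_zero, haq, sub_zero]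
  have hqbp : q * b * p = q * d * p := by
    rw [hd, mul_sub, sub_mul, mul_add, hqa, hq2, zero_add, hqp, sub_zero]
  have hs1 : ‖q * b * q + p - 1‖ ≤ δ := hqbq ▸ hcut q q hq1 hq1
  have hsu : IsUnit (q * b * q + p) := by
    have := isUnit_one_sub_of_norm_lt_one (x := 1 - (q * b * q + p))
      (by rw [norm_sub_rev]; linarith [hb.1])
    simpa using this
  have hss : IsSelfAdjoint (q * b * q + p) := by
    have := (hbs.conjugate q).add hp.isSelfAdjoint
    rwa [hqs] at this
  obtain ⟨s, hs⟩ := hsu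
  rw [← hs] at hs1 hss
  have hts : star (↑s⁻¹ : U) = ↑s⁻¹ := (isSelfAdjoint_units_inv hss).star_eq
  obtain ⟨t, ht⟩ : ∃ t : U, t = ↑s⁻¹ := ⟨_, rfl⟩
  rw [← ht] at hts
  have hts1 : t * s = 1 := by rw [ht, Units.inv_mul]
  have htn : ‖t‖ ≤ 2 := by
    have h1 : t = 1 - t * (s - 1) := by rw [mul_sub, hts1]; simp
    have h2 : ‖t‖ ≤ ‖(1 : U)‖ + ‖t‖ * ‖(s : U) - 1‖ := by
      conv_lhs => rw [h1]
      exact (norm_sub_le _ _).trans (add_le_add le_rfl (norm_mul_le _ _))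
    have h3 : ‖(1 : U)‖ ≤ 1 := (IsStarProjection.one (R := U)).norm_le
    nlinarith [norm_nonneg t, hb.1]
  have htq : t * (q * b * q) = q := by
    have : q * b * q = s * q := by rw [hs, add_mul, hpq, mul_assoc _ q q, hq2, add_zero]
    rw [this, ← mul_assoc, hts1, one_mul]
  -- The Schur complement of the `q`-block of `b`. The compression `p b p` alone need not be
  -- invertible in the corner, but the Schur complement is, with inverse `p b⁻¹ p`.
  obtain ⟨y, hy⟩ : ∃ y, y = p * b * p - p * b * q * t * (q * b * p) := ⟨_, rfl⟩
  have hys : star y = y := by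
    rw [hy]
    simp only [star_sub, star_mul, hps, hqs, hts, hbs.star_eq, mul_assoc]
  have hpy : p * y = y := by
    rw [hy, mul_sub]
    simp only [← mul_assoc, hp2]
  have hyp : y * p = y := by
    rw [hy, sub_mul]
    simp only [mul_assoc, hp2]
  have hbb : b * (↑β⁻¹ : U) = 1 := by rw [hbβ, Units.mul_inv]
  have hβs : star (↑β⁻¹ : U) = ↑β⁻¹ := (isSelfAdjoint_units_inv (hbβ ▸ hbs)).star_eq
  obtain ⟨γ, hγ⟩ : ∃ γ : U, γ = ↑β⁻¹ := ⟨_, rfl⟩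
  rw [← hγ] at hβs hbb
  have e1 : b * p * γ = 1 - b * q * γ := by
    rw [← hbb, eq_sub_iff_add_eq, ← add_mul, ← mul_add, hpq1, mul_one]
  have e2 : p * b * p * γ * p = p - p * b * q * γ * p := by
    calc p * b * p * γ * p = p * (b * p * γ) * p := by simp only [mul_assoc]
      _ = _ := by rw [e1, mul_sub, sub_mul, mul_one, hp2]; simp only [mul_assoc]
  have e3 : q * b * p * γ * p = - (q * b * q * γ * p) := by
    calc q * b * p * γ * p = q * (b * p * γ) * p := by simp only [mul_assoc]
      _ = _ := by rw [e1, mul_sub, sub_mul, mul_one, hqp, zero_sub]; simp only [mul_assoc]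
  have e4 : p * b * q * t * (q * b * p) * γ * p = - (p * b * q * γ * p) := by
    calc p * b * q * t * (q * b * p) * γ * p = p * b * q * t * (q * b * p * γ * p) := by
          simp only [mul_assoc]
      _ = - (p * b * q * (t * (q * b * q)) * γ * p) := by rw [e3]; simp only [mul_assoc, mul_neg]
      _ = _ := by rw [htq, mul_assoc (p * b), hq2]
  have e5 : y * (p * γ * p) = p := by
    calc y * (p * γ * p) = y * p * γ * p := by simp only [mul_assoc]
      _ = p * b * p * γ * p - p * b * q * t * (q * b * p) * γ * p := by
        rw [hyp, hy, sub_mul, sub_mul]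
      _ = p := by rw [e2, e4]; abel
  have e6 : p * γ * p * y = p := by
    have := congrArg star e5
    simpa only [star_mul, hps, hys, hβs, mul_assoc] using this
  refine ⟨y, hys, hpy, hyp, ?_, ?_⟩
  · have hyq : y * q = 0 := by rw [← hyp, mul_assoc, hpq, mul_zero]
    have hqy : q * y = 0 := by rw [← hpy, ← mul_assoc, hqp, zero_mul]
    refine ⟨⟨y + (1 - p), p * γ * p + q, ?_, ?_⟩, rfl⟩
    · rw [← hq, add_mul, mul_add, mul_add, e5, hyq, hq2, ← mul_assoc, ← mul_assoc, hqp]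
      simp [hpq1]
    · rw [← hq, add_mul, mul_add, mul_add, e6, hqy, hq2, mul_assoc _ p q, hpq]
      simp [hpq1]
  · have h1 : y - a = p * d * p - p * d * q * t * (q * d * p) := by
      rw [← hpbp, ← hpbq, ← hqbp, hy]; abel
    have h2 : ‖p * d * q * t * (q * d * p)‖ ≤ δ * 2 * δ :=
      calc _ ≤ ‖p * d * q‖ * ‖t‖ * ‖q * d * p‖ :=
            (norm_mul_le _ _).trans (mul_le_mul_of_nonneg_right (norm_mul_le _ _) (norm_nonneg _))
        _ ≤ δ * 2 * δ := by gcongr <;> apply hcut <;> assumption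
    calc ‖y - a‖ ≤ ‖p * d * p‖ + ‖p * d * q * t * (q * d * p)‖ := h1 ▸ norm_sub_le _ _
      _ ≤ δ + δ * 2 * δ := add_le_add (hcut p p hp1 hp1) h2
      _ < ε := by nlinarith [hb.1, hb.2]

/-- An element above `1` is invertible, and so is the scalar `n` unless the algebra is trivial.
Bounds such as `r ≤ 4 • (r * a * r)` enter `exists_polar` through this criterion. -/
theorem isUnit_of_one_le_nsmul {m : U} {n : ℕ} (hm : 1 ≤ n • m) : IsUnit m := by
  rcases subsingleton_or_nontrivial U with _ | _
  · exact isUnit_of_subsingleton m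
  have hn : n ≠ 0 := by
    rintro rfl
    rw [zero_smul] at hm
    exact one_ne_zero (le_antisymm hm zero_le_one)
  have h1 : IsUnit (n • m) := CStarAlgebra.isUnit_of_le 1 hm
  have h2 : n • m = algebraMap ℂ U n * m := by
    rw [map_natCast, nsmul_eq_mul]
  obtain ⟨k, hk⟩ := (isUnit_iff_ne_zero.2 (Nat.cast_ne_zero.2 hn : (n : ℂ) ≠ 0)).map
    (algebraMap ℂ U)
  rwa [h2, ← hk, Units.isUnit_units_mul] at h1

/-- Turns a norm approximation into order bounds, which survive compression by projections and
⋆-homomorphisms even when the two elements do not commute. -/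
theorem sub_one_le_and_le_add_one {a b : U} (ha : IsSelfAdjoint a) (hb : IsSelfAdjoint b)
    (h : ‖a - b‖ < 1) : b - 1 ≤ a ∧ a ≤ b + 1 := by
  have h1 := (ha.sub hb).le_algebraMap_norm_self
  have h2 := (ha.sub hb).neg_algebraMap_norm_le_self
  have h3 : algebraMap ℝ U ‖a - b‖ ≤ 1 := by
    rw [← map_one (algebraMap ℝ U)]
    exact algebraMap_mono U h.le
  constructor
  · have := (neg_le_neg h3).trans h2
    rwa [neg_le_sub_iff_le_add, ← sub_le_iff_le_add] at this
  · have := h1.trans h3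
    rwa [sub_le_iff_le_add'] at this

theorem IsStarProjection.conjugate_le {r a b : U} (hr : IsStarProjection r) (h : a ≤ b) :
    r * a * r ≤ r * b * r := by
  have := star_left_conjugate_le_conjugate h r
  rwa [hr.isSelfAdjoint.star_eq] at this

/-- Let `φ(p)` and `φ(q)` be equivalent via a partial isometry that lifts to the domain of `φ`.
If the domain has real rank zero, then `p` and `q` have equivalent sub-projections with the same
images. -/
theorem RealRankZeroUnital.exists_equiv_subproj (hU : RealRankZeroUnital U) (φ : U →⋆ₐ[ℂ] W)
    {p q x : U} (hp : IsStarProjection p) (hqx : q * x = x)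
    (hxp : x * p = x) (h1 : φ (star x * x) = φ p) (h2 : φ (x * star x) = φ q) :
    ∃ v : U, IsStarProjection (star v * v) ∧ IsStarProjection (v * star v) ∧
      p * (star v * v) = star v * v ∧ q * (v * star v) = v * star v ∧
      φ (star v * v) = φ p ∧ φ (v * star v) = φ q := by
  have hp2 : p * p = p := hp.isIdempotentElem.eq
  have hps : star p = p := hp.isSelfAdjoint.star_eq
  have hpx : p * star x = star x := by
    have := congrArg star hxp
    rwa [star_mul, hps] at this
  obtain ⟨a, ha⟩ : ∃ a, a = star x * x := ⟨_, rfl⟩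
  have has : IsSelfAdjoint a := ha ▸ .star_mul_self x
  have hpa : p * a = a := by rw [ha, ← mul_assoc, hpx]
  -- The scaling centres the cut at `a = 1/2` and leaves room for an error of `1`: `y ≥ 0` forces
  -- `4a ≥ 1`, and `y ≤ 0` forces `4a ≤ 3`, on the respective compressions.
  have ha's : IsSelfAdjoint (4 • a - 2 • p) := by
    simp only [IsSelfAdjoint, star_sub, star_nsmul, has.star_eq, hps]
  obtain ⟨y, hys, hpy, hyp, hyu, hya⟩ := hU.exists_isUnit_corner hp ha's
    (by rw [mul_sub, mul_smul_comm, mul_smul_comm, hpa, hp2]) one_pos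
  obtain ⟨hy1, hy2⟩ := sub_one_le_and_le_add_one hys ha's hya
  obtain ⟨e, he, hec, he1, he2⟩ :=
    exists_spectralProjection (hys.add hp.one_sub.isSelfAdjoint) hyu
  have hep : p * e = e * p := (hec p (by
    change _ = _
    rw [add_mul, mul_add, hyp, hpy, mul_sub, sub_mul, mul_one, one_mul])).eq.symm
  have hzp : (y + (1 - p)) * p = y := by
    rw [add_mul, hyp, sub_mul, one_mul, hp2, sub_self, add_zero]
  have proj_mul : ∀ f : U, IsStarProjection f → p * f = f * p → IsStarProjection (f * p) :=
    fun f hf h => ⟨by rw [IsIdempotentElem, mul_assoc, ← mul_assoc p, h, mul_assoc f p p, hp2,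
      ← mul_assoc, hf.isIdempotentElem.eq],
      by rw [IsSelfAdjoint, star_mul, hps, hf.isSelfAdjoint.star_eq, h]⟩
  have hye : y * e = e * y := by
    have h3 := (hec _ rfl).eq
    calc y * e = (y + (1 - p)) * e * p := by rw [mul_assoc, ← hep, ← mul_assoc, hzp]
      _ = e * y := by rw [← h3, mul_assoc, hzp]
  have cut : ∀ f : U, IsStarProjection f → p * f = f * p → y * f = f * y →
      f * p * y * (f * p) = p * (f * (y + (1 - p))) * p := fun f hf h h' => by
    rw [mul_assoc f p y, hpy, mul_assoc f y, ← mul_assoc y, h', mul_assoc f y p, hyp, ← mul_assoc,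
      hf.isIdempotentElem.eq, mul_assoc p, mul_assoc f, hzp, ← mul_assoc, h, mul_assoc, hpy]
  -- `r` and `s` split `p` into the parts where `y` is positive and negative; `e` itself also
  -- contains the complement `1 - p`.
  obtain ⟨r, hr⟩ : ∃ r, r = e * p := ⟨_, rfl⟩
  obtain ⟨s, hs⟩ : ∃ s, s = (1 - e) * p := ⟨_, rfl⟩
  have hep' : p * (1 - e) = (1 - e) * p := by rw [mul_sub, sub_mul, hep, mul_one, one_mul]
  have hrp : IsStarProjection r := hr ▸ proj_mul e he hep
  have hsp : IsStarProjection s := hs ▸ proj_mul _ he.one_sub hep'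
  have hrs : r + s = p := by rw [hr, hs, ← add_mul, add_sub_cancel, one_mul]
  have hpr : p * r = r := by rw [hr, ← mul_assoc, hep, mul_assoc, hp2]
  have hrp' : r * p = r := by rw [hr, mul_assoc, hp2]
  have hps' : p * s = s := by rw [hs, ← mul_assoc, hep', mul_assoc, hp2]
  have hry : 0 ≤ r * y * r := by
    have := hp.conjugate_le he1
    rw [mul_zero, zero_mul] at this
    rwa [hr, cut e he hep hye]
  have hsy : s * y * s ≤ 0 := by
    have := hp.conjugate_le he2
    rw [mul_zero, zero_mul] at this
    rwa [hs, cut _ he.one_sub hep' (by rw [mul_sub, sub_mul, hye, mul_one, one_mul])]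
  have hr2 := hrp.isIdempotentElem.eq
  have hra : r ≤ 4 • (r * a * r) := by
    have := hry.trans (hrp.conjugate_le hy2)
    have e : r * (4 • a - 2 • p + 1) * r = 4 • (r * a * r) - r := by
      simp only [mul_add, mul_sub, add_mul, sub_mul, mul_smul_comm, smul_mul_assoc, hrp', hr2,
        mul_one]
      abel
    rwa [e, sub_nonneg] at this
  -- Here `4 • (s * a * s) ≤ 3 • s`, while `φ a = φ p` acts as a unit on `φ s`. Hence `4 φ(s) ≤ 3
  -- φ(s)`.
  have hφs : φ s = 0 := by
    have h3 := (hsp.conjugate_le hy1).trans hsy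
    have e : s * (4 • a - 2 • p - 1) * s = 4 • (s * a * s) - 3 • s := by
      have : s * p * s = s := by rw [mul_assoc, hps', hsp.isIdempotentElem.eq]
      simp only [mul_sub, sub_mul, mul_smul_comm, smul_mul_assoc, this,
        mul_one, hsp.isIdempotentElem.eq]
      abel
    rw [e] at h3
    have h4 := OrderHomClass.mono φ h3
    have e2 : φ (s * a * s) = φ s := by
      rw [map_mul, map_mul, ha, h1, ← map_mul, ← map_mul, mul_assoc, hps',
        hsp.isIdempotentElem.eq]
    rw [map_sub, map_nsmul, map_nsmul, e2, map_zero, show 4 • φ s = 3 • φ s + φ s from succ_nsmul _ _,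
      add_sub_cancel_left] at h4
    exact le_antisymm h4 (hsp.map φ).nonneg
  have hφr : φ r = φ p := by rw [← hrs, map_add, hφs, add_zero]
  have hw : star (x * r) * (x * r) = r * a * r := by
    rw [star_mul, hrp.isSelfAdjoint.star_eq, ha]; simp only [mul_assoc]
  have hmu : IsUnit (star (x * r) * (x * r) + (1 - r)) := by
    refine isUnit_of_one_le_nsmul (n := 4) ?_
    rw [hw, smul_add]
    calc (1 : U) = r + (1 - r) := by abel
      _ ≤ 4 • (r * a * r) + 4 • (1 - r) := by
        exact add_le_add hra (le_self_nsmul hrp.one_sub.nonneg (by norm_num))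
  obtain ⟨g, hgs, hgr, hg1, hg2⟩ := exists_polar hrp (by rw [mul_assoc, hr2]) hmu
  obtain ⟨v, hv⟩ : ∃ v, v = x * r * g := ⟨_, rfl⟩
  rw [← hv] at hg2
  have hqv : q * v = v := by rw [hv, ← mul_assoc, ← mul_assoc, hqx]
  have hvr : v * r = v := by rw [hv, mul_assoc _ g, hgr.eq, ← mul_assoc, mul_assoc x, hr2]
  refine ⟨v, by rwa [hg2], ⟨?_, .mul_star_self v⟩, by rw [hg2, hpr],
    by rw [← mul_assoc, hqv], by rw [hg2, hφr], ?_⟩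
  · rw [IsIdempotentElem, mul_assoc, ← mul_assoc (star v), hg2, ← mul_assoc, hvr]
  · rw [hw] at hg1
    have h3 := congrArg φ hg1
    -- The element inverted by `g * g` is mapped to `1`, so `φ(g)² = 1` and the correction by `g`
    -- disappears from `φ (v * star v)`.
    have h4 : φ (r * a * r + (1 - r)) = 1 := by
      rw [map_add, map_mul, map_mul, ha, h1, map_sub, map_one, hφr, ← map_mul, ← map_mul, hp2, hp2,
        add_sub_cancel]
    rw [map_mul, h4, mul_one, map_one, map_mul] at h3
    have h5 : φ x * φ p = φ x := by rw [← map_mul, hxp]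
    have h6 : φ p * star (φ x) = star (φ x) := by rw [← map_star, ← map_mul, hpx]
    have h7 : star (φ p) = φ p := by rw [← map_star, hps]
    have h8 : star (φ g) = φ g := by rw [← map_star, hgs.star_eq]
    rw [hv, ← h2]
    simp only [map_mul, map_star, star_mul, hφr, h7, h8, h6, h5]
    rw [mul_assoc, ← mul_assoc (φ g), h3, one_mul]

/-- A projection `p` that lifts to a self-adjoint element lifts, up to equivalence, to a projection
if the domain has real rank zero. -/
theorem RealRankZeroUnital.exists_lift_projection (hU : RealRankZeroUnital U) (φ : U →⋆ₐ[ℂ] W)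
    {x : U} (hx : IsSelfAdjoint x) (hp : IsStarProjection (φ x)) :
    ∃ e : U, IsStarProjection e ∧ MvNEquiv (φ x) (φ e) := by
  -- The same scaling as before. The resulting `P = φ e` need not commute with `p = φ x`, so only
  -- compressions of one by the other can be bounded.
  have hx' : IsSelfAdjoint (4 • x - 2 • (1 : U)) := by
    simp only [IsSelfAdjoint, star_sub, star_nsmul, hx.star_eq, star_one]
  obtain ⟨b, ⟨hbs, hbu⟩, hb⟩ := Metric.mem_closure_iff.1 (hU hx') 1 one_pos
  rw [dist_comm, dist_eq_norm] at hb
  obtain ⟨hb1, hb2⟩ := sub_one_le_and_le_add_one hbs hx' hb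
  obtain ⟨e, he, hec, he1, he2⟩ := exists_spectralProjection hbs hbu
  have heb : b * e = e * b := (hec b rfl).eq.symm
  have he1' : 0 ≤ e * b * e := by
    rwa [mul_assoc, heb, ← mul_assoc, he.isIdempotentElem.eq]
  have hbe' : b * (1 - e) = (1 - e) * b := by rw [mul_sub, sub_mul, heb, mul_one, one_mul]
  have he2' : (1 - e) * b * (1 - e) ≤ 0 := by
    rwa [mul_assoc, hbe', ← mul_assoc, he.one_sub.isIdempotentElem.eq]
  obtain ⟨p, hpx⟩ : ∃ p, p = φ x := ⟨_, rfl⟩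
  obtain ⟨P, hPe⟩ : ∃ P, P = φ e := ⟨_, rfl⟩
  rw [← hpx] at hp
  have hP : IsStarProjection P := hPe ▸ he.map φ
  have hP2 := hP.isIdempotentElem.eq
  have hp2 := hp.isIdempotentElem.eq
  have hps := hp.isSelfAdjoint.star_eq
  have hPs := hP.isSelfAdjoint.star_eq
  have k1 : P ≤ 4 • (P * p * P) := by
    have := OrderHomClass.mono φ (he1'.trans (he.conjugate_le hb2))
    simp only [map_add, map_sub, map_mul, map_nsmul, map_one, map_zero, ← hpx, ← hPe] at this
    have e : P * (4 • p - 2 • 1 + 1) * P = 4 • (P * p * P) - P := by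
      simp only [mul_add, mul_sub, add_mul, sub_mul, mul_smul_comm, smul_mul_assoc, hP2, mul_one]
      abel
    rwa [e, sub_nonneg] at this
  have k2 : 4 • ((1 - P) * p * (1 - P)) ≤ 3 • (1 - P) := by
    have := OrderHomClass.mono φ ((he.one_sub.conjugate_le hb1).trans he2')
    simp only [map_sub, map_mul, map_nsmul, map_one, map_zero, ← hpx, ← hPe] at this
    have e : (1 - P) * (4 • p - 2 • 1 - 1) * (1 - P)
        = 4 • ((1 - P) * p * (1 - P)) - 3 • (1 - P) := by
      rw [mul_sub (1 - P), mul_sub (1 - P), sub_mul _ _ (1 - P), sub_mul _ _ (1 - P)]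
      simp only [mul_smul_comm, smul_mul_assoc, hP.one_sub.isIdempotentElem.eq, mul_one]
      abel
    rwa [e, sub_nonpos] at this
  -- The bound `k2` concerns `c c⋆` for `c = (1 - P) p`, whereas `p - p P p` is `c⋆ c`. The two have
  -- the same norm, so the constant `3/4` passes from one corner to the other.
  have k3 : p ≤ 4 • (p * P * p) := by
    obtain ⟨c, hc⟩ : ∃ c, c = (1 - P) * p := ⟨_, rfl⟩
    have c1 : c * star c = (1 - P) * p * (1 - P) := by
      rw [hc, star_mul, hps, star_sub, star_one, hPs, mul_assoc, ← mul_assoc p, hp2, ← mul_assoc]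
    have c2 : star c * c = p - p * P * p := by
      rw [hc, star_mul, hps, star_sub, star_one, hPs, mul_assoc, ← mul_assoc (1 - P),
        hP.one_sub.isIdempotentElem.eq, sub_mul, one_mul, mul_sub, hp2, mul_assoc]
    have three : algebraMap ℝ W 3 = 3 • (1 : W) := by
      rw [Algebra.algebraMap_eq_smul_one, ← Nat.cast_smul_eq_nsmul ℝ, Nat.cast_ofNat]
    have c3 : ‖4 • (c * star c)‖ ≤ 3 := by
      rw [CStarAlgebra.norm_le_iff_le_algebraMap _ (by norm_num)
        (nsmul_nonneg (mul_star_self_nonneg c) 4), c1]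
      refine k2.trans ((nsmul_le_nsmul_right (sub_le_self 1 hP.nonneg) 3).trans_eq three.symm)
    have c4 : 4 • (star c * c) ≤ 3 • (1 : W) := by
      have h3 : ‖4 • (star c * c)‖ ≤ 3 := by
        rw [← Nat.cast_smul_eq_nsmul ℝ, norm_smul] at c3 ⊢
        rwa [CStarRing.norm_star_mul_self, ← CStarRing.norm_self_mul_star]
      rw [CStarAlgebra.norm_le_iff_le_algebraMap _ (by norm_num)
        (nsmul_nonneg (star_mul_self_nonneg c) 4)] at h3
      exact h3.trans_eq three
    have c5 := hp.conjugate_le c4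
    have e : p * (4 • (p - p * P * p)) * p = 3 • p + (p - 4 • (p * P * p)) := by
      have : p * (p * P * p) * p = p * P * p := by
        simp only [← mul_assoc, hp2]
        rw [mul_assoc _ p p, hp2]
      simp only [mul_smul_comm, smul_mul_assoc, mul_sub, sub_mul, hp2, this]
      abel
    rwa [c2, e, mul_smul_comm, mul_one, smul_mul_assoc, hp2, add_le_iff_nonpos_right,
      sub_nonpos] at c5
  have hw : star (P * p) * (P * p) = p * P * p := by
    rw [star_mul, hps, hPs, mul_assoc, ← mul_assoc P, hP2, ← mul_assoc]
  have hu : IsUnit (star (P * p) * (P * p) + (1 - p)) := by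
    refine isUnit_of_one_le_nsmul (n := 4) ?_
    rw [hw, smul_add]
    calc (1 : W) = p + (1 - p) := by abel
      _ ≤ _ := add_le_add k3 (le_self_nsmul hp.one_sub.nonneg (by norm_num))
  have hu' : IsUnit (P * p * P + (1 - P)) := by
    refine isUnit_of_one_le_nsmul (n := 4) ?_
    rw [smul_add]
    calc (1 : W) = P + (1 - P) := by abel
      _ ≤ _ := add_le_add k1 (le_self_nsmul hP.one_sub.nonneg (by norm_num))
  obtain ⟨g, hgs, hgr, hg1, hg2⟩ := exists_polar hp (by rw [mul_assoc, hp2]) hu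
  refine ⟨e, he, P * p * g, by rw [hg2, hpx], ?_⟩
  rw [← hPe]
  obtain ⟨f, hf⟩ : ∃ f, f = P * p * g * star (P * p * g) := ⟨_, rfl⟩
  rw [← hf]
  have hf' : f = P * p * (g * g) * (p * P) := by
    rw [hf]; simp only [star_mul, hgs.star_eq, hps, hPs, mul_assoc]
  have hfP : f * P = f := by rw [hf']; simp only [mul_assoc, hP2]
  have hgp : g * g * (p * P * p) = p := by
    have := congrArg (· * p) hg1
    rw [hw] at this
    simpa only [mul_assoc, add_mul, sub_mul, hp2, one_mul, sub_self, add_zero] using this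
  have hfp : f * p = P * p := by
    calc f * p = P * p * (g * g * (p * P * p)) := by rw [hf']; simp only [mul_assoc]
      _ = P * p := by rw [hgp, mul_assoc, hp2]
  -- The range projection `f` of the partial isometry lies under `P`. The defect `P - f` annihilates
  -- an invertible element, which forces `f = P`.
  have h0 : (P - f) * (P * p * P + (1 - P)) = 0 := by
    have h1 : (P - f) * P = P - f := by rw [sub_mul, hP2, hfP]
    rw [mul_add, mul_sub, h1, mul_one, sub_self, add_zero, ← mul_assoc, ← mul_assoc, h1, sub_mul,
      hfp, sub_self, zero_mul]
  rw [hu'.mul_left_eq_zero, sub_eq_zero] at h0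
  exact h0.symm

end Unital

/-! ### Norm-controlled lifts and closed range of ⋆-homomorphisms -/

section StarHom

variable {D : Type u} [NonUnitalCStarAlgebra D] {D' : Type v} [NonUnitalCStarAlgebra D']

theorem continuous_starHom (φ : D →⋆ₙₐ[ℂ] D') : Continuous φ :=
  AddMonoidHomClass.continuous_of_bound φ 1 fun x => by
    simpa using NonUnitalStarAlgHom.norm_apply_le φ x

/-- Functional calculus clamps `x` to `[-‖φ x‖, ‖φ x‖]`. The spectrum of `φ x` already lies in this
interval, so the image is unchanged. -/
theorem exists_norm_le_of_isSelfAdjoint (φ : D →⋆ₙₐ[ℂ] D') {x : D} (hx : IsSelfAdjoint x) :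
    ∃ x' : D, φ x' = φ x ∧ ‖x'‖ ≤ ‖φ x‖ := by
  have hc := norm_nonneg (φ x)
  have hf : ∀ s : Set ℝ, ContinuousOn (fun t : ℝ => max (-‖φ x‖) (min t ‖φ x‖)) s :=
    fun s => by fun_prop
  have hf0 : (fun t : ℝ => max (-‖φ x‖) (min t ‖φ x‖)) 0 = 0 := by simp [hc]
  refine ⟨cfcₙ (fun t : ℝ => max (-‖φ x‖) (min t ‖φ x‖)) x, ?_, ?_⟩
  · rw [NonUnitalStarAlgHomClass.map_cfcₙ (S := ℂ) φ _ x (hf _) hf0 (continuous_starHom φ) hx (hx.map φ)]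
    refine (cfcₙ_congr fun t ht => ?_).trans (cfcₙ_id' ℝ (φ x) (hx.map φ))
    have h1 : |t| ≤ ‖φ x‖ := NonUnitalIsometricContinuousFunctionalCalculus.norm_quasispectrum_le (φ x) ht (hx.map φ)
    rw [abs_le] at h1
    rw [min_eq_left h1.2, max_eq_right h1.1]
  · refine norm_cfcₙ_le fun t _ => ?_
    rw [Real.norm_eq_abs, abs_le]
    exact ⟨le_max_left _ _, max_le (by linarith) (min_le_right _ _)⟩

/-- Every element in the range of a ⋆-homomorphism has a preimage of controlled norm. -/
theorem exists_norm_le_two_mul (φ : D →⋆ₙₐ[ℂ] D') (x : D) :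
    ∃ x' : D, φ x' = φ x ∧ ‖x'‖ ≤ 2 * ‖φ x‖ := by
  obtain ⟨a, ha, ha'⟩ := exists_norm_le_of_isSelfAdjoint φ (realPart x).2
  obtain ⟨b, hb, hb'⟩ := exists_norm_le_of_isSelfAdjoint φ (imaginaryPart x).2
  have h1 : ((realPart (φ x) : selfAdjoint D') : D') = φ (realPart x) := by
    simp [realPart_apply_coe, map_star, map_real_smul φ (continuous_starHom φ)]
  have h2 : ((imaginaryPart (φ x) : selfAdjoint D') : D') = φ (imaginaryPart x) := by
    simp [imaginaryPart_apply_coe, map_star, map_real_smul φ (continuous_starHom φ)]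
  refine ⟨a + Complex.I • b, ?_, ?_⟩
  · conv_rhs => rw [← realPart_add_I_smul_imaginaryPart x]
    rw [map_add, map_smul, ha, hb, map_add, map_smul]
  · calc ‖a + Complex.I • b‖ ≤ ‖a‖ + ‖Complex.I • b‖ := norm_add_le _ _
      _ ≤ ‖φ x‖ + ‖φ x‖ := by
        rw [norm_smul, Complex.norm_I, one_mul]
        exact add_le_add (ha'.trans (h1 ▸ realPart.norm_le (φ x)))
          (hb'.trans (h2 ▸ imaginaryPart.norm_le (φ x)))
      _ = _ := by ring

theorem isClosed_range_starHom (φ : D →⋆ₙₐ[ℂ] D') : IsClosed (Set.range φ) := by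
  let f : NormedAddGroupHom D D' := AddMonoidHom.mkNormedAddGroupHom (φ : D →+ D') 1
    fun x => by simpa using NonUnitalStarAlgHom.norm_apply_le φ x
  have hf : ∀ x, f x = φ x := fun _ => rfl
  -- A limit of the range is a convergent series of small elements of the range; lifting each term
  -- with norm at most doubled gives a convergent series in `D`.
  have h := controlled_closure_of_complete (f := f) (K := f.range) (C := 2) (ε := 1) two_pos one_pos
    (fun y hy => by
      obtain ⟨x, rfl⟩ := (f.mem_range y).1 hy
      exact exists_norm_le_two_mul φ x)
  refine isClosed_of_closure_subset fun y hy => ?_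
  have hy' : y ∈ f.range.topologicalClosure := by
    rw [← SetLike.mem_coe, AddSubgroup.topologicalClosure_coe]
    convert hy
    ext z
    exact f.mem_range z
  obtain ⟨x, hx, -⟩ := h y hy'
  exact ⟨x, hx⟩

end StarHom

/-! ### Exactness of `⊗ 𝒦` -/

namespace Stabilization

variable {A : Type u} [NonUnitalCStarAlgebra A] {B : Type v} [NonUnitalCStarAlgebra B]
  {E : Type w} [NonUnitalCStarAlgebra E]

attribute [local instance] CStarAlgebra.spectralOrder CStarAlgebra.spectralOrderedRing

/-- Injectivity alone need not survive completion, but isometry does. On each `Mₙ(A)`, itself a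
C⋆-algebra, an injective ⋆-homomorphism is isometric. -/
theorem norm_map_of_injective {f : A →⋆ₙₐ[ℂ] B} (hf : Function.Injective f)
    (x : Stabilization A) : ‖map f x‖ = ‖x‖ := by
  refine induction₁ (P := fun x => ‖map f x‖ = ‖x‖) x
    (isClosed_eq (continuous_lift _).norm continuous_norm) fun a => ?_
  obtain ⟨n, ha⟩ := a.exists_bound
  let θ : CStarMatrix (Fin n) (Fin n) A →⋆ₙₐ[ℂ] Stabilization B :=
    (map f).comp (ofHom.comp (FinMat.corner n))
  have hθ : ∀ M, θ M = of (FinMat.map f (FinMat.corner n M)) := fun M => map_of f _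
  have hinj : Function.Injective θ := fun M N h => by
    rw [hθ, hθ] at h
    have h1 := of.injective h
    have h2 : FinMat.corner n M = FinMat.corner n N := by
      ext i j
      have := congrArg (fun c => c.entry i j) h1
      exact hf (by simpa only [FinMat.map_entry] using this)
    rw [← FinMat.trunc_corner n M, h2, FinMat.trunc_corner]
  have h1 := NonUnitalStarAlgHom.norm_map θ hinj (FinMat.trunc n a)
  rw [hθ, FinMat.corner_trunc ha, ← FinMat.norm_eq ha] at h1
  rw [map_of, h1, LinearIsometry.norm_map]

theorem map_injective {f : A →⋆ₙₐ[ℂ] B} (hf : Function.Injective f) :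
    Function.Injective (map f) :=
  (injective_iff_map_eq_zero _).2 fun x hx => by
    rw [← norm_eq_zero, ← norm_map_of_injective hf, hx, norm_zero]

theorem finMat_map_surjective {f : A →⋆ₙₐ[ℂ] B} (hf : Function.Surjective f) :
    Function.Surjective (FinMat.map f) := fun b => by
  obtain ⟨n, hb⟩ := b.exists_bound
  choose g hg using hf
  refine ⟨⟨fun i j => if i < n ∧ j < n then g (b.entry i j) else 0, n,
    fun i j h => if_neg (by omega)⟩, ?_⟩
  ext i j
  rw [FinMat.map_entry]
  dsimp only
  split_ifs with h
  · exact hg _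
  · rw [map_zero, hb i j (by omega)]

theorem map_surjective {f : A →⋆ₙₐ[ℂ] B} (hf : Function.Surjective f) :
    Function.Surjective (map f) := fun y => by
  refine induction₁ (P := fun y => y ∈ Set.range (map f)) y (isClosed_range_starHom _) fun b => ?_
  obtain ⟨a, rfl⟩ := finMat_map_surjective hf b
  exact ⟨of a, map_of f a⟩

/-- `⊗ 𝒦` is an exact functor. -/
theorem map_exact {ι : B →⋆ₙₐ[ℂ] E} {π : E →⋆ₙₐ[ℂ] A} (h : Function.Exact ι π) :
    Function.Exact (map ι) (map π) := by
  refine fun x => ⟨fun hx => ?_, ?_⟩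
  · rw [← (isClosed_range_starHom (map ι)).closure_eq, Metric.mem_closure_iff]
    intro ε hε
    -- The matrix `a` is only near the kernel. Its image has norm below `ε / 3`, so a matrix `M` of
    -- norm below `2ε / 3` has the same image; `a - M` lies exactly in the kernel and is within `ε`
    -- of `x`.
    obtain ⟨_, ⟨a, rfl⟩, ha⟩ := Metric.mem_closure_iff.1 (denseRange_of x) (ε / 3) (by positivity)
    obtain ⟨n, hn⟩ := a.exists_bound
    let θ : CStarMatrix (Fin n) (Fin n) E →⋆ₙₐ[ℂ] Stabilization A :=
      (map π).comp (ofHom.comp (FinMat.corner n))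
    have hθ : ∀ M, θ M = of (FinMat.map π (FinMat.corner n M)) := fun M => map_of π _
    obtain ⟨M, hM, hM'⟩ := exists_norm_le_two_mul θ (FinMat.trunc n a)
    have h1 : ‖θ (FinMat.trunc n a)‖ < ε / 3 := by
      refine lt_of_le_of_lt ?_ ha
      rw [hθ, FinMat.corner_trunc hn, ← map_of, dist_comm, dist_eq_norm]
      calc ‖map π (of a)‖ = ‖map π (of a - x)‖ := by rw [map_sub, hx, sub_zero]
        _ ≤ _ := NonUnitalStarAlgHom.norm_apply_le _ _
    rw [hθ, hθ, FinMat.corner_trunc hn] at hM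
    have h2 := of.injective hM
    have h3 : ∀ i j, ∃ c, ι c = a.entry i j - (FinMat.corner n M).entry i j := fun i j => by
      refine (h _).1 ?_
      have := congrArg (fun c => c.entry i j) h2
      simp only [FinMat.map_entry] at this
      rw [map_sub, this, sub_self]
    choose c hc using h3
    let b : FinMat B := ⟨fun i j => if i < n ∧ j < n then c i j else 0, n,
      fun i j h => if_neg (by omega)⟩
    have hb : FinMat.map ι b = a - FinMat.corner n M := by
      ext i j
      rw [FinMat.map_entry]
      change ι (if i < n ∧ j < n then c i j else 0) = a.entry i j - (FinMat.corner n M).entry i j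
      split_ifs with hij
      · exact hc i j
      · rw [map_zero, hn i j (by omega), FinMat.corner_bound n M i j (by omega), sub_zero]
    refine ⟨map ι (of b), ⟨_, rfl⟩, ?_⟩
    rw [map_of, hb, map_sub]
    calc dist x (of a - of (FinMat.corner n M))
        ≤ dist x (of a) + dist (of a) (of a - of (FinMat.corner n M)) := dist_triangle _ _ _
      _ = dist x (of a) + ‖M‖ := by
        rw [dist_eq_norm (of a), sub_sub_cancel, LinearIsometry.norm_map, FinMat.norm_corner]
      _ < ε := by linarith
  · rintro ⟨y, rfl⟩
    refine induction₁ (P := fun y => map π (map ι y) = 0) y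
      (isClosed_eq ((continuous_lift _).comp (continuous_lift _)) continuous_const) fun b => ?_
    rw [map_of, map_of, ← map_zero of]
    congr 1
    ext i j
    simp [h.apply_apply_eq_zero]

end Stabilization

/-! ### Real rank zero and lifting in the non-unital case -/

section RealRankZero

variable {D : Type u} [NonUnitalCStarAlgebra D] {D' : Type v} [NonUnitalCStarAlgebra D']

theorem exists_isSelfAdjoint_lift {φ : D →⋆ₙₐ[ℂ] D'} (hφ : Function.Surjective φ) {y : D'}
    (hy : IsSelfAdjoint y) : ∃ x : D, IsSelfAdjoint x ∧ φ x = y := by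
  obtain ⟨x, rfl⟩ := hφ y
  refine ⟨realPart x, (realPart x).2, ?_⟩
  conv_rhs => rw [← hy.coe_realPart]
  simp [realPart_apply_coe, map_star, map_real_smul φ (continuous_starHom φ)]

theorem RealRankZero.of_surjective {φ : D →⋆ₙₐ[ℂ] D'} (hφ : Function.Surjective φ)
    (hD : RealRankZero D) : RealRankZero D' := fun y hy => by
  let ψ := Unitization.starMap φ
  have hψ : Function.Surjective ψ := Unitization.starMap_surjective hφ
  obtain ⟨x, hx, rfl⟩ := exists_isSelfAdjoint_lift
    (φ := (ψ : Unitization ℂ D →⋆ₙₐ[ℂ] Unitization ℂ D')) hψ hy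
  refine map_mem_closure (continuous_starHom (ψ : Unitization ℂ D →⋆ₙₐ[ℂ] Unitization ℂ D'))
    (hD hx) fun b hb => ⟨hb.1.map _, hb.2.map ψ⟩

/-- The scalar part of `v⋆ v` is the squared modulus of that of `v`. This brings partial isometries
and projections found in the unitization back to `D`. -/
theorem Unitization.eq_inr_of_fst_star_mul_self {v : Unitization ℂ D}
    (h : (star v * v).fst = 0) : v = (v.snd : Unitization ℂ D) := by
  have h1 : v.fst = 0 := by
    simpa only [Unitization.fst_mul, Unitization.fst_star, mul_eq_zero, star_eq_zero, or_self]
      using h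
  ext
  · simpa using h1
  · simp

theorem Unitization.fst_starMap (φ : D →⋆ₙₐ[ℂ] D') (z : Unitization ℂ D) :
    (Unitization.starMap φ z).fst = z.fst := by
  induction z with
  | inl_add_inr r a => simp [map_add, Unitization.algebraMap_eq_inl]

/-- If `φ(p) ∼ φ(q)`, then `p` and `q` have equivalent sub-projections with the same images. -/
theorem RealRankZero.exists_equiv_subproj (hD : RealRankZero D) {φ : D →⋆ₙₐ[ℂ] D'}
    (hφ : Function.Surjective φ) {p q : D} (hp : IsStarProjection p) (hq : IsStarProjection q)
    (h : MvNEquiv (φ p) (φ q)) :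
    ∃ v : D, IsStarProjection (star v * v) ∧ IsStarProjection (v * star v) ∧
      p * (star v * v) = star v * v ∧ q * (v * star v) = v * star v ∧
      φ (star v * v) = φ p ∧ φ (v * star v) = φ q := by
  obtain ⟨y, hy1, hy2⟩ := h
  obtain ⟨x, rfl⟩ := hφ y
  have hp2 := hp.isIdempotentElem.eq
  have hq2 := hq.isIdempotentElem.eq
  have hps := hp.isSelfAdjoint.star_eq
  have hqs := hq.isSelfAdjoint.star_eq
  have hP : φ p * φ p = φ p := by rw [← map_mul, hp2]
  have hQ : φ q * φ q = φ q := by rw [← map_mul, hq2]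
  -- An arbitrary lift `x` is cut down to `q x p`, which satisfies the support conditions of the
  -- unital lemma exactly and still has the right products in the quotient.
  have e1 : φ (star (q * x * p) * (q * x * p)) = φ p := by
    calc φ (star (q * x * p) * (q * x * p))
        = φ p * (star (φ x) * (φ q * φ q) * φ x) * φ p := by
          simp only [map_mul, star_mul, hps, hqs, map_star, mul_assoc]
      _ = φ p * ((star (φ x) * φ x) * (star (φ x) * φ x)) * φ p := by
          rw [hQ, ← hy2]; simp only [mul_assoc]
      _ = φ p := by rw [hy1]; simp only [hP]
  have e2 : φ (q * x * p * star (q * x * p)) = φ q := by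
    calc φ (q * x * p * star (q * x * p))
        = φ q * (φ x * (φ p * φ p) * star (φ x)) * φ q := by
          simp only [map_mul, star_mul, hps, hqs, map_star, mul_assoc]
      _ = φ q * ((φ x * star (φ x)) * (φ x * star (φ x))) * φ q := by
          rw [hP, ← hy1]; simp only [mul_assoc]
      _ = φ q := by rw [hy2]; simp only [hQ]
  obtain ⟨v, h1, h2, h3, h4, h5, h6⟩ := RealRankZeroUnital.exists_equiv_subproj hD
    (Unitization.starMap φ) (p := (p : Unitization ℂ D)) (q := (q : Unitization ℂ D))
    (x := ((q * x * p : D) : Unitization ℂ D)) (Unitization.isStarProjection_inr_iff.2 hp)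
    (by rw [← Unitization.inr_mul, ← mul_assoc, ← mul_assoc, hq2])
    (by rw [← Unitization.inr_mul, mul_assoc, hp2])
    (by rw [← Unitization.inr_star, ← Unitization.inr_mul, Unitization.starMap_inr, e1,
      Unitization.starMap_inr])
    (by rw [← Unitization.inr_star, ← Unitization.inr_mul, Unitization.starMap_inr, e2,
      Unitization.starMap_inr])
  have hv := Unitization.eq_inr_of_fst_star_mul_self (v := v) (by rw [← h3]; simp)
  obtain ⟨v, rfl⟩ : ∃ w : D, v = w := ⟨_, hv⟩
  simp only [← Unitization.inr_star, ← Unitization.inr_mul, Unitization.starMap_inr,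
    Unitization.isStarProjection_inr_iff] at h1 h2 h3 h4 h5 h6
  exact ⟨v, h1, h2, Unitization.inr_injective h3, Unitization.inr_injective h4,
    Unitization.inr_injective h5, Unitization.inr_injective h6⟩

/-- Up to equivalence, projections lift along surjections from algebras of real rank zero. -/
theorem RealRankZero.exists_lift_projection (hD : RealRankZero D) {φ : D →⋆ₙₐ[ℂ] D'}
    (hφ : Function.Surjective φ) {p : D'} (hp : IsStarProjection p) :
    ∃ e : D, IsStarProjection e ∧ MvNEquiv p (φ e) := by
  obtain ⟨x, hx, rfl⟩ := exists_isSelfAdjoint_lift hφ hp.isSelfAdjoint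
  obtain ⟨e, he, u, hu1, hu2⟩ := RealRankZeroUnital.exists_lift_projection hD
    (Unitization.starMap φ) (x := (x : Unitization ℂ D)) (hx.inr ℂ)
    (by rwa [Unitization.starMap_inr, Unitization.isStarProjection_inr_iff])
  rw [Unitization.starMap_inr] at hu1
  have hu := Unitization.eq_inr_of_fst_star_mul_self (v := u) (by rw [hu1]; simp)
  obtain ⟨u, rfl⟩ : ∃ w : D', u = w := ⟨_, hu⟩
  -- The unitized map preserves scalar parts, and the image of `e` is `u u⋆` with `u` in `D'`.
  have he0 : (star e * e).fst = 0 := by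
    rw [he.isSelfAdjoint.star_eq, he.isIdempotentElem.eq, ← Unitization.fst_starMap φ, ← hu2]
    simp
  have he' := Unitization.eq_inr_of_fst_star_mul_self he0
  obtain ⟨e, rfl⟩ : ∃ w : D, e = w := ⟨_, he'⟩
  rw [Unitization.starMap_inr] at hu2
  rw [← Unitization.inr_star, ← Unitization.inr_mul] at hu1 hu2
  exact ⟨e, Unitization.isStarProjection_inr_iff.1 he, u, Unitization.inr_injective hu1,
    Unitization.inr_injective hu2⟩

end RealRankZero

/-! ### Infinite projections and differences of projections -/

section Infinite

variable {D : Type u} [NonUnitalCStarAlgebra D] {D' : Type v} [NonUnitalCStarAlgebra D']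

theorem IsInfiniteCStar.of_injective {φ : D →⋆ₙₐ[ℂ] D'} (hφ : Function.Injective φ)
    (h : IsInfiniteCStar D) : IsInfiniteCStar D' := by
  obtain ⟨p, hp, q, hq, hqp, hne, hpq⟩ := h
  exact ⟨φ p, hp.map φ, φ q, hq.map φ, by rw [IsSubproj, ← map_mul, show p * q = q from hqp],
    fun h => hne (hφ h), hpq.map φ⟩

theorem isInfiniteCStar_congr (e : D ≃⋆ₐ[ℂ] D') : IsInfiniteCStar D ↔ IsInfiniteCStar D' :=
  ⟨.of_injective (φ := (e : D →⋆ₙₐ[ℂ] D')) e.injective,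
    .of_injective (φ := (e.symm : D' →⋆ₙₐ[ℂ] D)) e.symm.injective⟩

theorem MvNEquiv.eq_zero {p : D} (h : MvNEquiv p 0) : p = 0 := by
  obtain ⟨x, rfl, hx⟩ := h
  rw [CStarRing.mul_star_self_eq_zero_iff] at hx
  rw [hx, mul_zero]

theorem IsStarProjection.sub_of_isSubproj {p q : D} (hp : IsStarProjection p)
    (hq : IsStarProjection q) (h : IsSubproj q p) : IsStarProjection (p - q) ∧ q * (p - q) = 0 := by
  have h1 : p * q = q := h
  have h2 : q * p = q := by
    have := congrArg star h1
    rwa [star_mul, hp.isSelfAdjoint.star_eq, hq.isSelfAdjoint.star_eq] at this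
  have hq2 := hq.isIdempotentElem.eq
  refine ⟨⟨?_, hp.isSelfAdjoint.sub hq.isSelfAdjoint⟩, by rw [mul_sub, h2, hq2, sub_self]⟩
  rw [IsIdempotentElem, sub_mul, mul_sub, mul_sub, h1, h2, hq2, sub_self, sub_zero,
    hp.isIdempotentElem.eq]

end Infinite

/-! ### Infiniteness and extensions in terms of `V` -/

namespace VSemigroup

open Stabilization

variable {A : Type u} [NonUnitalCStarAlgebra A] {B : Type v} [NonUnitalCStarAlgebra B]
  {E : Type w} [NonUnitalCStarAlgebra E]

theorem mk_eq_zero {p : Stabilization A} {hp : IsStarProjection p} : mk p hp = 0 ↔ p = 0 := by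
  refine ⟨fun h => (mk_eq_mk.1 h).eq_zero, ?_⟩
  rintro rfl
  rfl

theorem mk_add_of_orthogonal {p q r : Stabilization A} (hp : IsStarProjection p)
    (hq : IsStarProjection q) (hr : IsStarProjection r) (hpq : p * q = 0) (hr' : p + q = r) :
    mk r hr = mk p hp + mk q hq := by
  subst hr'
  have hqp : q * p = 0 := by
    have := congrArg star hpq
    rwa [star_mul, hp.isSelfAdjoint.star_eq, hq.isSelfAdjoint.star_eq, star_zero] at this
  rw [mk_add_mk, mk_eq_mk]
  -- The column with entries `p` and `q`: its cross terms are `p q` and `q p`, which vanish by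
  -- orthogonality.
  refine ⟨shift evenEmb (.refl ℕ) p + shift oddEmb (.refl ℕ) q, ?_, ?_⟩ <;>
  simp only [dsum, star_add, ← shift_star, mul_add, add_mul, shift_mul,
      shift_mul_eq_zero _ _ _ _ even_ne_odd, shift_mul_eq_zero _ _ _ _
        (fun i j => (even_ne_odd j i).symm), add_zero, zero_add, hp.isSelfAdjoint.star_eq,
      hq.isSelfAdjoint.star_eq, hp.isIdempotentElem.eq, hq.isIdempotentElem.eq, shift_refl, hpq,
      hqp, shift_zero]

theorem mk_sub_add {p q : Stabilization A} (hp : IsStarProjection p) (hq : IsStarProjection q)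
    (h : IsSubproj q p) : mk p hp = mk q hq + mk (p - q) (hp.sub_of_isSubproj hq h).1 :=
  mk_add_of_orthogonal _ _ _ (hp.sub_of_isSubproj hq h).2 (add_sub_cancel _ _)

/-- `A ⊗ 𝒦` is infinite if and only if some class of `V(A)` absorbs a nonzero class. -/
theorem isInfiniteCStar_stabilization_iff :
    IsInfiniteCStar (Stabilization A) ↔ ∃ x z : VSemigroup A, z ≠ 0 ∧ x + z = x := by
  constructor
  · rintro ⟨p, hp, q, hq, hqp, hne, hpq⟩
    refine ⟨mk q hq, mk (p - q) (hp.sub_of_isSubproj hq hqp).1, ?_, ?_⟩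
    · rw [Ne, mk_eq_zero, sub_eq_zero]
      exact fun h => hne h.symm
    · rw [← mk_sub_add hp hq hqp, mk_eq_mk]
      exact hpq
  · rintro ⟨x, z, hz, hxz⟩
    induction x using ind with | h p hp
    induction z using ind with | h q hq
    rw [Ne, mk_eq_zero] at hz
    have hd0 : IsStarProjection (dsum p 0) := isStarProjection_dsum hp (.zero _)
    have hd := isStarProjection_dsum hp hq
    -- With `x = [p]` and `z = [q]`, absorption says `p ⊕ q ∼ p ⊕ 0`, a sub-projection that is
    -- proper because `q ≠ 0`.
    refine ⟨dsum p q, hd, dsum p 0, hd0, ?_, fun h => hz ?_, ?_⟩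
    · rw [IsSubproj, dsum_mul, hp.isIdempotentElem.eq, mul_zero]
    · have h1 : shift oddEmb oddEmb q = 0 := by
        simpa only [dsum, shift_zero, add_right_inj] using h.symm
      have h2 := mvnEquiv_shift hq oddEmb
      rw [h1] at h2
      exact h2.symm.eq_zero
    · rw [mk_add_mk] at hxz
      have h1 : mk p hp + 0 = mk (dsum p 0) hd0 := rfl
      rw [add_zero] at h1
      rw [← mk_eq_mk (hp := hd) (hq := hd0), hxz, h1]

section Extension

variable {ι : B →⋆ₙₐ[ℂ] E} {π : E →⋆ₙₐ[ℂ] A}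

/-- `V(ι)` maps onto the kernel of `V(π)`. -/
theorem map_eq_zero_iff (h : IsCStarExtension ι π) {x : VSemigroup E} :
    map π x = 0 ↔ x ∈ Set.range (map ι) := by
  induction x using ind with | h p hp
  rw [map_mk, mk_eq_zero]
  constructor
  · intro h0
    obtain ⟨q, rfl⟩ := (map_exact h.exact p).1 h0
    -- Injectivity of `ι ⊗ id` makes the preimage of a projection a projection.
    have hinj := map_injective h.injective
    have hq : IsStarProjection q :=
      ⟨hinj (by rw [map_mul]; exact hp.isIdempotentElem.eq),
        hinj (by rw [map_star]; exact hp.isSelfAdjoint.star_eq)⟩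
    exact ⟨mk q hq, map_mk ι hq⟩
  · rintro ⟨y, hy⟩
    induction y using ind with | h q hq
    rw [map_mk, mk_eq_mk] at hy
    have h1 := hy.map (Stabilization.map π)
    rw [(map_exact h.exact).apply_apply_eq_zero] at h1
    exact h1.symm.eq_zero

/-- `V(A)` is the quotient of `V(E)` by `V(B)`. -/
theorem map_eq_map_iff (h : IsCStarExtension ι π) (hE : RealRankZero (Stabilization E))
    {x y : VSemigroup E} :
    map π x = map π y ↔ ∃ b c : VSemigroup B, x + map ι b = y + map ι c := by
  constructor
  · induction x using ind with | h p hp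
    induction y using ind with | h q hq
    rw [map_mk, map_mk, mk_eq_mk]
    intro hpq
    obtain ⟨v, h1, h2, h3, h4, h5, h6⟩ :=
      hE.exists_equiv_subproj (map_surjective h.surjective) hp hq hpq
    have hker : ∀ {p r : Stabilization E} (hp : IsStarProjection p) (hr : IsStarProjection r)
        (hrp : IsSubproj r p), Stabilization.map π r = Stabilization.map π p →
        mk (p - r) (hp.sub_of_isSubproj hr hrp).1 ∈ Set.range (map ι) := fun hp hr hrp hrp' => by
      rw [← map_eq_zero_iff h, map_mk, mk_eq_zero, map_sub, hrp', sub_self]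
    obtain ⟨c, hc⟩ := hker hp h1 h3 h5
    obtain ⟨b, hb⟩ := hker hq h2 h4 h6
    -- The common part `v⋆ v ∼ v v⋆` is shared by `p` and `q`. Each side is completed by the
    -- remainder of the other, and both remainders die in the quotient, hence come from `V(B)`.
    refine ⟨b, c, ?_⟩
    rw [hb, hc, mk_sub_add hp h1 h3, mk_sub_add hq h2 h4,
      show mk (star v * v) h1 = mk (v * star v) h2 from mk_eq_mk.2 ⟨v, rfl, rfl⟩, add_right_comm]
  · rintro ⟨b, c, hbc⟩
    have h0 : ∀ b, map π (map ι b) = 0 := fun b => (map_eq_zero_iff h).2 ⟨b, rfl⟩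
    simpa only [map_add, h0, add_zero] using congrArg (map π) hbc

theorem map_surjective_of_realRankZero (h : IsCStarExtension ι π)
    (hE : RealRankZero (Stabilization E)) : Function.Surjective (map π) := fun x => by
  induction x using ind with | h p hp
  obtain ⟨e, he, hpe⟩ := hE.exists_lift_projection (map_surjective h.surjective) hp
  exact ⟨mk e he, by rw [map_mk, mk_eq_mk]; exact hpe.symm⟩

/-- The infiniteness of the quotient in an extension, in terms of `V(B)` and `V(E)`. -/
theorem isInfiniteCStar_iff_of_extension (h : IsCStarExtension ι π) (hsE : IsStable E)
    (hsA : IsStable A) (hrE : RealRankZero E) :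
    IsInfiniteCStar A ↔ ∃ (x z : VSemigroup E) (b c : VSemigroup B), z ∉ Set.range (map ι) ∧
      x + z + map ι b = x + map ι c := by
  obtain ⟨eE⟩ := hsE
  obtain ⟨eA⟩ := hsA
  -- The lifting takes place in `E ⊗ 𝒦`, which inherits real rank zero through `E ≅ E ⊗ 𝒦`.
  have hE : RealRankZero (Stabilization E) :=
    hrE.of_surjective (φ := (eE : E →⋆ₙₐ[ℂ] Stabilization E)) eE.surjective
  rw [isInfiniteCStar_congr eA, isInfiniteCStar_stabilization_iff]
  have hsurj := map_surjective_of_realRankZero h hE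
  simp only [hsurj.exists, Ne, map_eq_zero_iff h, ← map_add, map_eq_map_iff h hE,
    exists_and_left]

end Extension

end VSemigroup

open VSemigroup in
-- One direction suffices, the data being symmetric. The criterion involves only addition in `V(E)`
-- and membership in the range of `V(ι)`, and both are transported by `α`.
theorem isInfiniteCStar_of_isInfiniteCStar {B₁ E₁ A₁ B₂ E₂ A₂ : Type*}
    [NonUnitalCStarAlgebra B₁] [NonUnitalCStarAlgebra E₁] [NonUnitalCStarAlgebra A₁]
    [NonUnitalCStarAlgebra B₂] [NonUnitalCStarAlgebra E₂] [NonUnitalCStarAlgebra A₂]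
    {ι₁ : B₁ →⋆ₙₐ[ℂ] E₁} {π₁ : E₁ →⋆ₙₐ[ℂ] A₁} {ι₂ : B₂ →⋆ₙₐ[ℂ] E₂} {π₂ : E₂ →⋆ₙₐ[ℂ] A₂}
    (hext₁ : IsCStarExtension ι₁ π₁) (hext₂ : IsCStarExtension ι₂ π₂)
    (hsE₁ : IsStable E₁) (hsA₁ : IsStable A₁) (hsE₂ : IsStable E₂) (hsA₂ : IsStable A₂)
    (hrE₁ : RealRankZero E₁) (hrE₂ : RealRankZero E₂)
    (α : VSemigroup E₁ ≃+o VSemigroup E₂) (α₀ : VSemigroup B₁ ≃+o VSemigroup B₂)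
    (hα : ∀ x : VSemigroup B₁, α (VSemigroup.map ι₁ x) = VSemigroup.map ι₂ (α₀ x))
    (h : IsInfiniteCStar A₁) : IsInfiniteCStar A₂ := by
  rw [isInfiniteCStar_iff_of_extension hext₁ hsE₁ hsA₁ hrE₁] at h
  rw [isInfiniteCStar_iff_of_extension hext₂ hsE₂ hsA₂ hrE₂]
  obtain ⟨x, z, b, c, hz, hxz⟩ := h
  refine ⟨α x, α z, α₀ b, α₀ c, ?_, ?_⟩
  -- Surjectivity of `α₀` is what prevents `α z` from falling into the range of `V(ι₂)`.
  · rintro ⟨t, ht⟩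
    obtain ⟨s, rfl⟩ := EquivLike.surjective α₀ t
    rw [← hα] at ht
    exact hz ⟨s, EquivLike.injective α ht⟩
  · rw [← hα, ← hα, ← map_add, ← map_add, ← map_add, hxz]

end

theorem lemma4p11 {B₁ E₁ A₁ B₂ E₂ A₂ : Type*}
    [NonUnitalCStarAlgebra B₁] [NonUnitalCStarAlgebra E₁] [NonUnitalCStarAlgebra A₁]
    [NonUnitalCStarAlgebra B₂] [NonUnitalCStarAlgebra E₂] [NonUnitalCStarAlgebra A₂]
    (ι₁ : B₁ →⋆ₙₐ[ℂ] E₁) (π₁ : E₁ →⋆ₙₐ[ℂ] A₁) (ι₂ : B₂ →⋆ₙₐ[ℂ] E₂) (π₂ : E₂ →⋆ₙₐ[ℂ] A₂)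
    (hext₁ : IsCStarExtension ι₁ π₁) (hext₂ : IsCStarExtension ι₂ π₂)
    (hsB₁ : IsStable B₁) (hsE₁ : IsStable E₁) (hsA₁ : IsStable A₁)
    (hsB₂ : IsStable B₂) (hsE₂ : IsStable E₂) (hsA₂ : IsStable A₂)
    (hrB₁ : RealRankZero B₁) (hrE₁ : RealRankZero E₁) (hrA₁ : RealRankZero A₁)
    (hrB₂ : RealRankZero B₂) (hrE₂ : RealRankZero E₂) (hrA₂ : RealRankZero A₂)
    (α : VSemigroup E₁ ≃+o VSemigroup E₂) (α₀ : VSemigroup B₁ ≃+o VSemigroup B₂)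
    (hα : ∀ x : VSemigroup B₁, α (VSemigroup.map ι₁ x) = VSemigroup.map ι₂ (α₀ x)) :
    IsInfiniteCStar A₁ ↔ IsInfiniteCStar A₂ := by
  refine ⟨isInfiniteCStar_of_isInfiniteCStar hext₁ hext₂ hsE₁ hsA₁ hsE₂ hsA₂ hrE₁ hrE₂ α α₀ hα,
    isInfiniteCStar_of_isInfiniteCStar hext₂ hext₁ hsE₂ hsA₂ hsE₁ hsA₁ hrE₂ hrE₁ α.symm α₀.symm
      fun x => ?_⟩
  -- The commuting square for the inverses, obtained by writing `x` as `α₀ y`.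
  obtain ⟨y, rfl⟩ := EquivLike.surjective α₀ x
  rw [← hα]
  exact (α.symm_apply_apply _).trans (congrArg _ (α₀.symm_apply_apply y).symm)
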